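/- Let $\lambda_b>0$, $\alpha>2$, and let $K,L\ge 1$ be integers. Suppose that the base stations (BSs) form a homogeneous Poisson point process (HPPP) of density $\lambda_b$ on the plane $\mathbb R^2$, and let $r_{0,1}\le r_{0,2}\le\cdots$ be the distances from the origin to the BSs in increasing order. Let $\mathbf P_K=L\sum_{i=1}^K r_{0,i}^{-\alpha}$. Let $\Gamma(s,q)=\int_q^\infty t^{s-1}e^{-t}\,dt$ ($s\in\mathbb R$, $q>0$) denote the upper incomplete gamma function, and for $0\le i\le K$ define $A_{i,0}=1$ and $$A_{i,j}=\frac1j\sum_{\ell=1}^{j}\bigl(\ell(i+1)-j\bigr)\,\frac{2}{\ell!\,(2-\ell\alpha)}\,A_{i,j-\ell}\qquad(j\ge 1).$$ Then $\mathbf P_K$ is a random variable, whose CDF is $$F_P(x)=P\Bigl(\sum_{i=1}^K r_{0,i}^{-\alpha}\le \frac xL\Bigr)\qquad(x\in\mathbb R),$$ where, for every $x>0$, $$\begin{aligned}P\Bigl(\sum_{i=1}^K r_{0,i}^{-\alpha}\le x\Bigr)={}&e^{-\lambda_b\pi(K/x)^{2/\alpha}}\sum_{\ell=0}^{K}\frac{\bigl(\lambda_b\pi(K/x)^{2/\alpha}\bigr)^\ell}{\ell!}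 +\frac1\pi\sum_{\ell=1}^{K}\binom K\ell\Bigl(-\Gamma\bigl(1-\tfrac2\alpha\bigr)\Bigr)^\ell\sin\Bigl(\frac{2\pi\ell}{\alpha}\Bigr)\\ &\times\sum_{m=0}^\infty A_{K-\ell,m}\,\Gamma\bigl(m+\tfrac2\alpha\ell\bigr)\,x^{-m-\frac2\alpha\ell}\,\frac1{K!}\,(\lambda_b\pi)^{\frac12 m\alpha+\ell}\,\Gamma\Bigl(K-\frac{m\alpha}2-\ell+1,\ \Bigl(\frac Kx\Bigr)^{2/\alpha}\lambda_b\pi\Bigr),\end{aligned}$$ each of the infinite series over $m$ being absolutely convergent, and $P\bigl(\sum_{i=1}^K r_{0,i}^{-\alpha}\le x\bigr)=0$ for $x\le 0$. -/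

import Mathlib

open MeasureTheory ProbabilityTheory

noncomputable section

namespace CoopBS

/-- The Euclidean plane in which the base stations are located. -/
abbrev Plane : Type := EuclideanSpace ℝ (Fin 2)

/-- `Φ` is a homogeneous Poisson point process of density `lam` on the plane: a random locally
finite set of points such that the number of points in a bounded Borel set `B` is Poisson
distributed with mean `lam` times the area of `B`, and the numbers of points in pairwise disjoint
bounded Borel sets are independent. -/
structure IsHPPP {Ω : Type*} [MeasurableSpace Ω] (P : Measure Ω) (lam : ℝ)
    (Φ : Ω → Set Plane) : Prop where
  finite_inter : ∀ ω, ∀ B : Set Plane, Bornology.IsBounded B → (Φ ω ∩ B).Finite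
  measurable_count : ∀ B : Set Plane, MeasurableSet B → Bornology.IsBounded B →
    Measurable (fun ω => (Φ ω ∩ B).ncard)
  map_count : ∀ B : Set Plane, MeasurableSet B → Bornology.IsBounded B →
    P.map (fun ω => (Φ ω ∩ B).ncard) = poissonMeasure (lam * volume.real B).toNNReal
  indep_count : ∀ (n : ℕ) (B : Fin n → Set Plane), (∀ k, MeasurableSet (B k)) →
    (∀ k, Bornology.IsBounded (B k)) → Pairwise (fun k l => Disjoint (B k) (B l)) →
    iIndepFun (fun k ω => (Φ ω ∩ B k).ncard) P

/-- The distance from the origin to the `i`-th nearest point of `S` (`i = 1, 2, …`): the least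
radius of a closed disk centred at the origin that contains at least `i` points of `S`. -/
def nearestDist (S : Set Plane) (i : ℕ) : ℝ :=
  sInf {r : ℝ | 0 ≤ r ∧ (i : ℕ∞) ≤ (S ∩ Metric.closedBall 0 r).encard}

/-- `∑_{i ≤ K} r_{0,i}^{-α}`, with `r_{0,i}` the distance from the origin to the `i`-th nearest
point of `S`. -/
def pathLossSum (α : ℝ) (K : ℕ) (S : Set Plane) : ℝ :=
  ∑ i ∈ Finset.Icc 1 K, nearestDist S i ^ (-α)

/-- The total average power `P_K = L ∑_{i ≤ K} r_{0,i}^{-α}` received from the mobile at the origin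
by the `K` nearest base stations, each of which has `L` antennas. -/
def receivedPower (α : ℝ) (L K : ℕ) (S : Set Plane) : ℝ :=
  (L : ℝ) * pathLossSum α K S

/-- The upper incomplete gamma function `Γ(s, q) = ∫_q^∞ t^{s-1} e^{-t} dt` (for `q > 0` and
arbitrary real `s`). -/
def upperGamma (s q : ℝ) : ℝ :=
  ∫ t in Set.Ioi q, t ^ (s - 1) * Real.exp (-t)

/-- The coefficients `A_{i,j}`; see `coeffA_zero` and `coeffA_eq` for the recursion in its usual
form. -/
def coeffA (α : ℝ) (i : ℕ) : ℕ → ℝ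
  | 0 => 1
  | j + 1 => 1 / ((j : ℝ) + 1) * ∑ l : Fin (j + 1),
      (((l : ℕ) + 1 : ℝ) * ((i : ℝ) + 1) - ((j : ℝ) + 1)) *
        (2 / ((((l : ℕ) + 1).factorial : ℝ) * (2 - ((l : ℕ) + 1 : ℝ) * α))) *
        coeffA α i (j - (l : ℕ))
  termination_by j => j
  decreasing_by omega

theorem coeffA_zero (α : ℝ) (i : ℕ) : coeffA α i 0 = 1 := by
  rw [coeffA]

theorem coeffA_eq (α : ℝ) (i j : ℕ) (hj : 0 < j) :
    coeffA α i j = 1 / (j : ℝ) * ∑ l ∈ Finset.Icc 1 j,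
      ((l : ℝ) * ((i : ℝ) + 1) - (j : ℝ)) * (2 / ((l.factorial : ℝ) * (2 - (l : ℝ) * α))) *
        coeffA α i (j - l) := by
  obtain ⟨j, rfl⟩ : ∃ k, j = k + 1 := ⟨j - 1, by omega⟩
  rw [coeffA, Finset.sum_fin_eq_sum_range, ← Finset.Ico_add_one_right_eq_Icc,
    Finset.sum_Ico_eq_sum_range]
  push_cast
  congr 1
  refine Finset.sum_congr (by simp) fun l hl => ?_
  have hl' : l < j + 1 := by simpa using hl
  have e : j + 1 - (1 + l) = j - l := by omega
  rw [dif_pos hl', e, add_comm 1 l, add_comm (1 : ℝ) (l : ℝ)]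

/-- The `m`-th term of the series attached to `ℓ` in the formula for the distribution function. -/
def cdfTerm (α lam : ℝ) (K : ℕ) (x : ℝ) (l m : ℕ) : ℝ :=
  coeffA α (K - l) m * Real.Gamma ((m : ℝ) + 2 / α * (l : ℝ)) *
    x ^ (-(m : ℝ) - 2 / α * (l : ℝ)) * (1 / (K.factorial : ℝ)) *
    (lam * Real.pi) ^ (1 / 2 * (m : ℝ) * α + (l : ℝ)) *
    upperGamma ((K : ℝ) - (m : ℝ) * α / 2 - (l : ℝ) + 1)
      (((K : ℝ) / x) ^ (2 / α) * lam * Real.pi)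

/-- The explicit expression for `P(∑_{i ≤ K} r_{0,i}^{-α} ≤ x)`, `x > 0`. -/
def cdfFormula (α lam : ℝ) (K : ℕ) (x : ℝ) : ℝ :=
  Real.exp (-(lam * Real.pi * ((K : ℝ) / x) ^ (2 / α))) *
      ∑ l ∈ Finset.range (K + 1),
        (lam * Real.pi * ((K : ℝ) / x) ^ (2 / α)) ^ l / (l.factorial : ℝ) +
    1 / Real.pi * ∑ l ∈ Finset.Icc 1 K,
      (K.choose l : ℝ) * (-Real.Gamma (1 - 2 / α)) ^ l * Real.sin (2 * Real.pi * (l : ℝ) / α) *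
        ∑' m : ℕ, cdfTerm α lam K x l m

end CoopBS

end

/-! Write `c = lam * π`, `δ = 2 / α` and `u_i = c * r_i ^ 2`. Counting points in concentric shells
shows that the `u_i` are the arrivals of a unit-rate Poisson process on the half-line: the first `K
+ 1` of them, `u_1 < ⋯ < u_K < t`, have joint density `e^(-t)` on the cone of increasing positive
sequences (`map_arrivals`). So `t` has the Erlang density `e^(-t) t^K / K!`, and given `t` the
others are the order statistics of `K` independent uniform variables on `(0, t)`. The path-loss sum
is symmetric, so the order is irrelevant, and for uniform `u` the variable `(u / t)^(-α/2)` is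
Pareto with density `δ z^(-δ-1)` on `[1, ∞)`. With `F` the distribution function of a sum of `K`
such variables, the probability sought is `∫ e^(-t) t^K / K! * F(x (t / c)^(α/2)) dt`
(`measure_pathLossSum_le`).

The core is a series for `F(y)`, `y > K`. Replace `-δ` by `s > 0`. The measure `z^(s-1) dz` on `[1,
∞)` is then the difference of those on `(0, ∞)` and `(0, 1)`, both locally finite, and its
convolution power expands binomially (`IsLocFiniteNonneg.convPow_real_Iic`). Powers of the first are
explicit by the Beta integral; powers of the second live on `[0, j]`, with moments generated by
powers of one power series. Expanding `(1 - w / y)^(s l)` and integrating termwise gives the formula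
for `δ = -s < 0` (`paretoFormula_neg`). Both sides are analytic in `δ` for `Re δ < 1`: the left side
is a power of `δ` times a moment generating function in the logarithms of the variables, and the
right side converges locally uniformly. The identity theorem carries the formula to `δ = 2 / α`, and
the reflection formula for `Γ` produces the sines (`paretoCDF_eq`). The recursion for `A_{i,j}` is
that for coefficients of the `i`-th power of a power series (`coeffA_eq_coeff`).

Finally `F` vanishes below `K`, which cuts the integral at `t = (K / x)^(2/α) c`. The constant `1`
in `F` integrates to the Erlang tail and each series term to an upper incomplete gamma function; the
values of the terms at `y = K` dominate and justify the interchange. -/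

noncomputable section

namespace CoopBS

open scoped ENNReal Nat

/-! ### Convolution powers of measures -/

/-- The `n`-fold convolution power of a measure. -/
def convPow {M : Type*} [AddMonoid M] [MeasurableSpace M] (μ : Measure M) : ℕ → Measure M
  | 0 => Measure.dirac 0
  | n + 1 => μ ∗ convPow μ n

section convPow

variable {M : Type*} [AddCommMonoid M] [MeasurableSpace M]

instance sFinite_convPow (μ : Measure M) [SFinite μ] (n : ℕ) : SFinite (convPow μ n) := by
  induction n with
  | zero => rw [convPow]; infer_instance
  | succ n ih => rw [convPow]; infer_instance

theorem convPow_smul (μ : Measure M) [SFinite μ] (c : ℝ≥0∞) (n : ℕ) :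
    convPow (c • μ) n = c ^ n • convPow μ n := by
  induction n with
  | zero => simp [convPow]
  | succ n ih =>
    rw [convPow, convPow, ih, Measure.conv_smul_left, Measure.conv_smul_right, smul_smul, pow_succ']

variable [MeasurableAdd₂ M]

/-- A density multiplicative over sums factors out of the convolution integral. It is applied below
to an exponential tilt. -/
theorem conv_withDensity {μ ν : Measure M} [SFinite μ] [SFinite ν] {g : M → ℝ≥0∞}
    (hg : Measurable g) (hadd : ∀ x y, g (x + y) = g x * g y) :
    (μ.withDensity g) ∗ (ν.withDensity g) = (μ ∗ ν).withDensity g := by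
  refine Measure.ext_of_lintegral _ fun f hf => ?_
  rw [Measure.lintegral_conv hf, lintegral_withDensity_eq_lintegral_mul _ hg (by fun_prop),
    lintegral_withDensity_eq_lintegral_mul _ hg hf, Measure.lintegral_conv (by fun_prop)]
  refine lintegral_congr fun x => ?_
  simp only [Pi.mul_apply]
  rw [lintegral_withDensity_eq_lintegral_mul _ hg (by fun_prop),
    ← lintegral_const_mul _ (by fun_prop)]
  refine lintegral_congr fun y => ?_
  simp only [Pi.mul_apply, hadd, mul_assoc]

theorem convPow_withDensity {μ : Measure M} [SFinite μ] {g : M → ℝ≥0∞}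
    (hg : Measurable g) (h0 : g 0 = 1) (hadd : ∀ x y, g (x + y) = g x * g y) (n : ℕ) :
    convPow (μ.withDensity g) n = (convPow μ n).withDensity g := by
  induction n with
  | zero =>
    refine Measure.ext_of_lintegral _ fun f hf => ?_
    rw [convPow, convPow, lintegral_withDensity_eq_lintegral_mul _ hg hf, lintegral_dirac' _ hf,
      lintegral_dirac' _ (hg.mul hf)]
    simp [h0]
  | succ n ih => rw [convPow, convPow, ih, conv_withDensity hg hadd]

theorem convPow_map {N : Type*} [AddCommMonoid N] [MeasurableSpace N] [MeasurableAdd₂ N]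
    (μ : Measure M) [SFinite μ] (L : M →+ N) (hL : Measurable L) (n : ℕ) :
    convPow (μ.map L) n = (convPow μ n).map L := by
  induction n with
  | zero => rw [convPow, convPow, Measure.map_dirac' hL, map_zero]
  | succ n ih => rw [convPow, convPow, ih, Measure.map_conv_addMonoidHom L hL]

theorem map_sum_pi {α : Type*} [MeasurableSpace α] (μ : Measure α) [SigmaFinite μ] {f : α → M}
    (hf : Measurable f) (n : ℕ) :
    (Measure.pi fun _ : Fin n => μ).map (fun v => ∑ i, f (v i)) = convPow (μ.map f) n := by
  induction n with
  | zero =>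
    rw [convPow]
    have : (fun v : Fin 0 → α => ∑ i, f (v i)) = fun _ => 0 := by ext; simp
    rw [this, Measure.map_const]
    simp
  | succ n ih =>
    have hmeas (k : ℕ) : Measurable fun v : Fin k → α => ∑ i, f (v i) :=
      Finset.measurable_sum _ fun i _ => hf.comp (measurable_pi_apply i)
    have hmp := measurePreserving_piFinSuccAbove (fun _ : Fin (n + 1) => μ) 0
    rw [convPow, ← ih, Measure.conv, Measure.map_prod_map _ _ hf (hmeas n),
      Measure.map_map (by fun_prop) (by fun_prop), ← hmp.map_eq,
      Measure.map_map (by fun_prop) hmp.measurable]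
    congr 1
    ext v
    simp [Fin.sum_univ_succ, MeasurableEquiv.piFinSuccAbove, Fin.tail]

end convPow

/-! ### Measures on the half-line and binomial inversion -/

/-- A measure on the line that is carried by `[0, ∞)` and finite on bounded-above sets. -/
structure IsLocFiniteNonneg (μ : Measure ℝ) : Prop where
  sFinite : SFinite μ
  Iio_zero : μ (Set.Iio 0) = 0
  Iic_lt_top : ∀ y, μ (Set.Iic y) < ∞

namespace IsLocFiniteNonneg

theorem ae_nonneg {μ : Measure ℝ} (h : IsLocFiniteNonneg μ) : ∀ᵐ x ∂μ, 0 ≤ x := by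
  rw [ae_iff]
  simpa [Set.Iio] using h.Iio_zero

theorem dirac_zero : IsLocFiniteNonneg (Measure.dirac 0) :=
  ⟨inferInstance, by simp, fun _ => measure_lt_top _ _⟩

theorem conv_Iic {μ ν : Measure ℝ} [SFinite ν] (y : ℝ) :
    (μ ∗ ν) (Set.Iic y) = ∫⁻ x, ν (Set.Iic (y - x)) ∂μ := by
  rw [← lintegral_indicator_one measurableSet_Iic, Measure.lintegral_conv (by measurability)]
  refine lintegral_congr fun x => ?_
  rw [← lintegral_indicator_one measurableSet_Iic]
  refine lintegral_congr fun z => ?_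
  simp [Set.indicator_apply, le_sub_iff_add_le']

theorem conv {μ ν : Measure ℝ} (hμ : IsLocFiniteNonneg μ) (hν : IsLocFiniteNonneg ν) :
    IsLocFiniteNonneg (μ ∗ ν) := by
  have := hμ.sFinite
  have := hν.sFinite
  refine ⟨inferInstance, ?_, fun y => ?_⟩
  · rw [← lintegral_indicator_one measurableSet_Iio, Measure.lintegral_conv (by measurability)]
    rw [lintegral_eq_zero_of_ae_eq_zero]
    filter_upwards [hμ.ae_nonneg] with x hx
    rw [Pi.zero_apply]
    apply lintegral_eq_zero_of_ae_eq_zero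
    filter_upwards [hν.ae_nonneg] with z hz
    simp [add_nonneg hx hz]
  · rw [conv_Iic]
    -- The integrand is at most `ν (Set.Iic y)` for `0 ≤ x ≤ y` and vanishes for `x > y`.
    calc ∫⁻ x, ν (Set.Iic (y - x)) ∂μ
        ≤ ∫⁻ x, (Set.Iic y).indicator (fun _ => ν (Set.Iic y)) x ∂μ := by
          refine lintegral_mono_ae ?_
          filter_upwards [hμ.ae_nonneg] with x hx
          by_cases hxy : x ≤ y
          · rw [Set.indicator_of_mem (by exact hxy)]
            exact measure_mono (Set.Iic_subset_Iic.2 (by linarith))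
          · rw [Set.indicator_of_notMem (by exact hxy), nonpos_iff_eq_zero,
              ← nonpos_iff_eq_zero, ← hν.Iio_zero]
            refine measure_mono fun z hz => ?_
            simp only [Set.mem_Iic, Set.mem_Iio] at *
            linarith
      _ = ν (Set.Iic y) * μ (Set.Iic y) := by
          rw [lintegral_indicator measurableSet_Iic]; simp
      _ < ∞ := ENNReal.mul_lt_top (hν.Iic_lt_top y) (hμ.Iic_lt_top y)

theorem convPow {μ : Measure ℝ} (hμ : IsLocFiniteNonneg μ) (n : ℕ) :
    IsLocFiniteNonneg (convPow μ n) := by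
  induction n with
  | zero => exact dirac_zero
  | succ n ih => exact hμ.conv ih

theorem real_conv_Iic {μ ν : Measure ℝ} (hν : IsLocFiniteNonneg ν)
    (y : ℝ) : (μ ∗ ν).real (Set.Iic y) = ∫ x, ν.real (Set.Iic (y - x)) ∂μ := by
  have := hν.sFinite
  rw [measureReal_def, conv_Iic, ← integral_toReal]
  · rfl
  · have : Antitone fun x => ν (Set.Iic (y - x)) := fun a b hab =>
      measure_mono (Set.Iic_subset_Iic.2 (by linarith))
    exact this.measurable.aemeasurable
  · exact Filter.Eventually.of_forall fun x => hν.Iic_lt_top _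

/-- Binomial inversion of `a = b + e` in the convolution powers. -/
theorem convPow_real_Iic {a b e : Measure ℝ} (hb : IsLocFiniteNonneg b)
    (he : IsLocFiniteNonneg e) (hab : a = b + e) (i j l : ℕ) (y : ℝ) :
    (CoopBS.convPow e i ∗ (CoopBS.convPow b j ∗ CoopBS.convPow a l)).real (Set.Iic y) =
      ∑ p ∈ Finset.range (i + 1), (i.choose p : ℝ) * (-1) ^ (i - p) *
        (CoopBS.convPow b (j + (i - p)) ∗ CoopBS.convPow a (l + p)).real (Set.Iic y) := by
  have ha : IsLocFiniteNonneg a := by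
    have := hb.sFinite
    have := he.sFinite
    subst hab
    exact ⟨inferInstance, by simp [hb.Iio_zero, he.Iio_zero],
      fun y => by simpa using ⟨hb.Iic_lt_top y, he.Iic_lt_top y⟩⟩
  have := ha.sFinite
  have := hb.sFinite
  have := he.sFinite
  induction i generalizing j l with
  | zero => simp [CoopBS.convPow]
  | succ i ih =>
    have key : (CoopBS.convPow e i ∗ (CoopBS.convPow b j ∗ CoopBS.convPow a (l + 1))) =
        (CoopBS.convPow e i ∗ (CoopBS.convPow b (j + 1) ∗ CoopBS.convPow a l)) +
        (CoopBS.convPow e (i + 1) ∗ (CoopBS.convPow b j ∗ CoopBS.convPow a l)) := by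
      have h1 : CoopBS.convPow b j ∗ CoopBS.convPow a (l + 1) =
          CoopBS.convPow b (j + 1) ∗ CoopBS.convPow a l +
          e ∗ (CoopBS.convPow b j ∗ CoopBS.convPow a l) := by
        rw [show CoopBS.convPow a (l + 1) = (b + e) ∗ CoopBS.convPow a l by
          rw [← hab]; rfl, show CoopBS.convPow b (j + 1) = b ∗ CoopBS.convPow b j from rfl,
          ← Measure.conv_assoc, ← Measure.conv_assoc, ← Measure.add_conv,
          Measure.conv_comm _ (b + e), Measure.add_conv]
      rw [h1, Measure.conv_add, ← Measure.conv_assoc _ e, Measure.conv_comm _ e]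
      rfl
    -- One factor `e` is traded for `a - b`. The subtraction is made on real values, which is
    -- legitimate since every mass of `Set.Iic y` here is finite.
    have key2 : (CoopBS.convPow e (i + 1) ∗ (CoopBS.convPow b j ∗ CoopBS.convPow a l)).real
          (Set.Iic y) =
        (CoopBS.convPow e i ∗ (CoopBS.convPow b j ∗ CoopBS.convPow a (l + 1))).real (Set.Iic y) -
        (CoopBS.convPow e i ∗ (CoopBS.convPow b (j + 1) ∗ CoopBS.convPow a l)).real
          (Set.Iic y) := by
      rw [key, measureReal_add_apply
        (((he.convPow i).conv ((hb.convPow _).conv (ha.convPow l))).Iic_lt_top y).ne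
        (((he.convPow _).conv ((hb.convPow j).conv (ha.convPow l))).Iic_lt_top y).ne]
      ring
    rw [key2, ih, ih, Finset.sum_range_succ' _ (i + 1), Finset.sum_range_succ]
    have e1 : ∑ p ∈ Finset.range (i + 1), ((i + 1).choose (p + 1) : ℝ) * (-1) ^ (i + 1 - (p + 1)) *
        (CoopBS.convPow b (j + (i + 1 - (p + 1))) ∗ CoopBS.convPow a (l + (p + 1))).real
          (Set.Iic y) = ∑ p ∈ Finset.range (i + 1), (i.choose p : ℝ) * (-1) ^ (i - p) *
        (CoopBS.convPow b (j + (i - p)) ∗ CoopBS.convPow a (l + 1 + p)).real (Set.Iic y) +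
        ∑ p ∈ Finset.range (i + 1), (i.choose (p + 1) : ℝ) * (-1) ^ (i - p) *
        (CoopBS.convPow b (j + (i - p)) ∗ CoopBS.convPow a (l + (p + 1))).real (Set.Iic y) := by
      rw [← Finset.sum_add_distrib]
      refine Finset.sum_congr rfl fun p _ => ?_
      rw [Nat.choose_succ_succ, Nat.add_sub_add_right, show l + 1 + p = l + (p + 1) by ring]
      push_cast
      ring
    have e2 : ∑ p ∈ Finset.range (i + 1), (i.choose p : ℝ) * (-1) ^ (i - p) *
        (CoopBS.convPow b (j + 1 + (i - p)) ∗ CoopBS.convPow a (l + p)).real (Set.Iic y) =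
        (-1) ^ i * (CoopBS.convPow b (j + (i + 1)) ∗ CoopBS.convPow a l).real (Set.Iic y) -
        ∑ p ∈ Finset.range (i + 1), (i.choose (p + 1) : ℝ) * (-1) ^ (i - p) *
        (CoopBS.convPow b (j + (i - p)) ∗ CoopBS.convPow a (l + (p + 1))).real (Set.Iic y) := by
      rw [Finset.sum_range_succ' _ i, Finset.sum_range_succ _ i]
      have : ∑ p ∈ Finset.range i, (i.choose (p + 1) : ℝ) * (-1) ^ (i - (p + 1)) *
          (CoopBS.convPow b (j + 1 + (i - (p + 1))) ∗ CoopBS.convPow a (l + (p + 1))).real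
            (Set.Iic y) = - ∑ p ∈ Finset.range i, (i.choose (p + 1) : ℝ) * (-1) ^ (i - p) *
          (CoopBS.convPow b (j + (i - p)) ∗ CoopBS.convPow a (l + (p + 1))).real (Set.Iic y) := by
        rw [← Finset.sum_neg_distrib]
        refine Finset.sum_congr rfl fun p hp => ?_
        have hp' : p < i := by simpa using hp
        obtain ⟨q, rfl⟩ : ∃ q, i = p + 1 + q := ⟨i - (p + 1), by omega⟩
        rw [show p + 1 + q - (p + 1) = q by omega, show p + 1 + q - p = q + 1 by omega,
          show j + 1 + q = j + (q + 1) by ring]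
        ring
      rw [this]
      simp only [Nat.choose_zero_right, Nat.choose_succ_self, Nat.cast_one, Nat.cast_zero]
      rw [show j + 1 + (i - 0) = j + (i + 1) by omega, Nat.sub_zero, add_zero]
      ring
    rw [← Finset.sum_range_succ, e1, e2]
    simp only [Nat.choose_zero_right, Nat.cast_one, Nat.sub_zero, add_zero, pow_succ]
    ring

end IsLocFiniteNonneg

/-! ### Divided powers, rising factorials and the binomial series -/

theorem add_pow_div_factorial (x w : ℝ) (m : ℕ) :
    (x + w) ^ m / m ! = ∑ p ∈ Finset.HasAntidiagonal.antidiagonal m,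
      (x ^ p.1 / p.1 !) * (w ^ p.2 / p.2 !) := by
  rw [(Commute.all x w).add_pow', Finset.sum_div]
  refine Finset.sum_congr rfl fun p hp => ?_
  rw [← Finset.HasAntidiagonal.mem_antidiagonal.1 hp, nsmul_eq_mul, Nat.cast_add_choose]
  have := Nat.factorial_ne_zero (p.1 + p.2)
  field_simp

section rising

/-- The rising factorial `s (s + 1) ⋯ (s + m - 1)`. -/
def rising {F : Type*} [CommRing F] (s : F) (m : ℕ) : F := ∏ i ∈ Finset.range m, (s + i)

theorem rising_succ {F : Type*} [CommRing F] (s : F) (m : ℕ) :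
    rising s (m + 1) = rising s m * (s + m) := Finset.prod_range_succ _ _

theorem rising_zero_right {F : Type*} [CommRing F] (s : F) : rising s 0 = 1 := by simp [rising]

theorem rising_zero_left {F : Type*} [CommRing F] {m : ℕ} (hm : m ≠ 0) : rising (0 : F) m = 0 :=
  Finset.prod_eq_zero (i := 0) (by simpa using Nat.pos_of_ne_zero hm) (by simp)

theorem rising_nonneg {s : ℝ} (hs : 0 ≤ s) (m : ℕ) : 0 ≤ rising s m :=
  Finset.prod_nonneg fun _ _ => by positivity

theorem rising_mono {s t : ℝ} (hs : 0 ≤ s) (hst : s ≤ t) (m : ℕ) : rising s m ≤ rising t m :=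
  Finset.prod_le_prod (fun _ _ => by positivity) fun _ _ => by gcongr

theorem norm_rising_le {𝕜 : Type*} [RCLike 𝕜] (s : 𝕜) (m : ℕ) : ‖rising s m‖ ≤ rising ‖s‖ m := by
  rw [rising, norm_prod]
  refine Finset.prod_le_prod (fun _ _ => norm_nonneg _) fun i _ => ?_
  exact (norm_add_le _ _).trans (by simp)

theorem ofReal_rising (s : ℝ) (m : ℕ) : ((rising s m : ℝ) : ℂ) = rising (s : ℂ) m := by
  simp [rising]

theorem choose_eq_rising (s : ℝ) (m : ℕ) : Ring.choose (s + m - 1) m = rising s m / m ! := by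
  have h1 : Ring.choose (s + m - 1) m = Ring.multichoose s m := by
    rw [Ring.choose]; congr 1; ring
  have h2 := Ring.factorial_nsmul_multichoose_eq_ascPochhammer s m
  rw [Polynomial.ascPochhammer_smeval_eq_eval] at h2
  have h3 : (ascPochhammer ℝ m).eval s = rising s m := by
    clear h1 h2
    induction m with
    | zero => simp [rising]
    | succ m ih => rw [ascPochhammer_succ_right, rising_succ, ← ih]; simp
  rw [h1, eq_div_iff (by positivity), ← h3, ← h2]
  simp [mul_comm]

theorem hasSum_rising (s : ℝ) {x : ℝ} (hx : |x| < 1) :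
    HasSum (fun m : ℕ => rising s m / m ! * x ^ m) ((1 - x) ^ (-s)) := by
  have h := (Real.one_div_one_sub_rpow_hasFPowerSeriesOnBall_zero s).hasSum (y := x)
    (by rw [← ENNReal.ofReal_one, Metric.eball_ofReal]; simpa using hx)
  rw [zero_add] at h
  have hx' : 0 ≤ 1 - x := by linarith [(abs_lt.1 hx).2]
  rw [Real.rpow_neg hx', ← one_div]
  have e : (fun m : ℕ => rising s m / m ! * x ^ m) = fun m =>
      (FormalMultilinearSeries.ofScalars ℝ (fun n : ℕ => Ring.choose (s + n - 1) n) m)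
        fun _ => x := by
    ext m
    rw [← choose_eq_rising]
    simp [mul_comm]
  rwa [e]

theorem summable_rising {c r : ℝ} (hr0 : 0 ≤ r) (hr : r < 1) :
    Summable (fun m : ℕ => rising c m / m ! * r ^ m) :=
  (hasSum_rising c (by rwa [abs_of_nonneg hr0])).summable

theorem Gamma_nat_add {s : ℝ} (hs : 0 < s) (m : ℕ) :
    Real.Gamma (m + s) = rising s m * Real.Gamma s := by
  induction m with
  | zero => simp [rising]
  | succ m ih =>
    rw [rising_succ, show ((m + 1 : ℕ) : ℝ) + s = (m + s) + 1 by push_cast; ring,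
      Real.Gamma_add_one (by positivity), ih]
    ring

end rising

/-! ### Power-law measures and their convolution powers -/

section powMeasure

/-- The measure `z ^ (s - 1) dz` on the set `I`. -/
def powMeasure (I : Set ℝ) (s : ℝ) : Measure ℝ :=
  (volume.restrict I).withDensity fun z => ENNReal.ofReal (z ^ (s - 1))

instance (I : Set ℝ) (s : ℝ) : SFinite (powMeasure I s) := by
  rw [powMeasure]; infer_instance

theorem measurable_ofReal_rpow (s : ℝ) : Measurable fun z : ℝ => ENNReal.ofReal (z ^ s) := by
  fun_prop

theorem powMeasure_apply (I : Set ℝ) (s : ℝ) {J : Set ℝ} (hJ : MeasurableSet J) :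
    powMeasure I s J = ∫⁻ z in J ∩ I, ENNReal.ofReal (z ^ (s - 1)) := by
  rw [powMeasure, withDensity_apply _ hJ, Measure.restrict_restrict hJ]

theorem integral_powMeasure {I : Set ℝ} (hI : MeasurableSet I) (h0 : I ⊆ Set.Ici 0) (s : ℝ)
    (f : ℝ → ℝ) : ∫ z, f z ∂(powMeasure I s) = ∫ z in I, z ^ (s - 1) * f z := by
  rw [powMeasure, integral_withDensity_eq_integral_toReal_smul (measurable_ofReal_rpow _)
    (by simp)]
  refine setIntegral_congr_fun hI fun z hz => ?_
  simp only [smul_eq_mul]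
  rw [ENNReal.toReal_ofReal (Real.rpow_nonneg (h0 hz) _)]

theorem ae_powMeasure_mem {I : Set ℝ} (hI : MeasurableSet I) (s : ℝ) :
    ∀ᵐ z ∂(powMeasure I s), z ∈ I :=
  (withDensity_absolutelyContinuous _ _).ae_le (ae_restrict_mem hI)

theorem isLocFiniteNonneg_powMeasure {I : Set ℝ}
    (h0 : I ⊆ Set.Ici 0) (s : ℝ)
    (hfin : ∀ y, 0 ≤ y → IntegrableOn (fun z : ℝ => z ^ (s - 1)) (Set.Iic y ∩ I)) :
    IsLocFiniteNonneg (powMeasure I s) := by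
  have hz : powMeasure I s (Set.Iio 0) = 0 := by
    rw [powMeasure_apply _ _ measurableSet_Iio]
    have : Set.Iio (0 : ℝ) ∩ I = ∅ := by
      ext z; simp only [Set.mem_inter_iff, Set.mem_Iio, Set.mem_empty_iff_false, iff_false]
      rintro ⟨h1, h2⟩
      have := h0 h2
      simp only [Set.mem_Ici] at this
      linarith
    simp [this]
  refine ⟨inferInstance, hz, fun y => ?_⟩
  rcases lt_or_ge y 0 with hy | hy
  · rw [measure_mono_null (fun z hz => ?_) hz]
    · simp
    · simp only [Set.mem_Iic, Set.mem_Iio] at *; linarith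
  · rw [powMeasure_apply _ _ measurableSet_Iic]
    exact (hfin y hy).lintegral_lt_top

theorem isLocFiniteNonneg_powMeasure_Ioi {s : ℝ} (hs : 0 < s) :
    IsLocFiniteNonneg (powMeasure (Set.Ioi 0) s) := by
  refine isLocFiniteNonneg_powMeasure Set.Ioi_subset_Ici_self s fun y hy => ?_
  rw [Set.Iic_inter_Ioi, ← intervalIntegrable_iff_integrableOn_Ioc_of_le hy]
  exact intervalIntegral.intervalIntegrable_rpow' (by linarith)

theorem isLocFiniteNonneg_powMeasure_Ioo {s : ℝ} (hs : 0 < s) :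
    IsLocFiniteNonneg (powMeasure (Set.Ioo 0 1) s) := by
  refine isLocFiniteNonneg_powMeasure (fun x hx => hx.1.le) s fun y hy => ?_
  refine IntegrableOn.mono_set (t := Set.Ioo 0 1) ?_ Set.inter_subset_right
  rw [← intervalIntegrable_iff_integrableOn_Ioo_of_le zero_le_one]
  exact intervalIntegral.intervalIntegrable_rpow' (by linarith)

/-- Away from the singularity at `0` every exponent is allowed. The exponent finally needed is `-(2
/ α) < 0`, for which the measures on `(0, 1)` and `(0, ∞)` are not locally finite at `0`; hence the
analytic continuation below. -/
theorem isLocFiniteNonneg_powMeasure_Ici (s : ℝ) :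
    IsLocFiniteNonneg (powMeasure (Set.Ici 1) s) := by
  refine isLocFiniteNonneg_powMeasure (fun x (hx : 1 ≤ x) => zero_le_one.trans hx) s fun y _ => ?_
  refine IntegrableOn.mono_set (t := Set.Icc 1 y) ?_ (fun z hz => ⟨hz.2, hz.1⟩)
  refine ContinuousOn.integrableOn_Icc fun z hz => ?_
  exact (Real.continuousAt_rpow_const _ _
    (Or.inl (by linarith [hz.1]))).continuousWithinAt

theorem powMeasure_Ioi_eq_add (s : ℝ) :
    powMeasure (Set.Ioi 0) s = powMeasure (Set.Ioo 0 1) s + powMeasure (Set.Ici 1) s := by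
  rw [powMeasure, powMeasure, powMeasure, ← withDensity_add_measure, ← Measure.restrict_union
    (Set.disjoint_left.2 fun (x : ℝ) (hx : x ∈ Set.Ioo 0 1) (hx' : x ∈ Set.Ici 1) =>
      absurd hx.2 (not_lt.2 hx')) measurableSet_Ici,
    Set.Ioo_union_Ici_eq_Ioi zero_lt_one]

theorem integral_Ioo_rpow_mul_sub_rpow {s c y : ℝ} (hs : 0 < s) (hc : 0 ≤ c) (hy : 0 < y) :
    ∫ x in Set.Ioo 0 y, x ^ (s - 1) * (y - x) ^ c =
      y ^ (s + c) * (Real.Gamma s * Real.Gamma (c + 1) / Real.Gamma (s + c + 1)) := by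
  have h := Complex.betaIntegral_scaled (s : ℂ) ((c + 1 : ℝ) : ℂ) hy
  rw [Complex.betaIntegral_eq_Gamma_mul_div _ _ (by simpa) (by simp; linarith),
    intervalIntegral.integral_of_le hy.le, integral_Ioc_eq_integral_Ioo] at h
  have h1 : ∫ x in Set.Ioo 0 y, (x : ℂ) ^ ((s : ℂ) - 1) * ((y : ℂ) - x) ^ (((c + 1 : ℝ) : ℂ) - 1) =
      ((∫ x in Set.Ioo 0 y, x ^ (s - 1) * (y - x) ^ c : ℝ) : ℂ) := by
    rw [← integral_complex_ofReal]
    refine setIntegral_congr_fun measurableSet_Ioo fun x hx => ?_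
    rw [Complex.ofReal_mul, Complex.ofReal_cpow hx.1.le,
      Complex.ofReal_cpow (by linarith [hx.2] : 0 ≤ y - x)]
    push_cast
    rw [add_sub_cancel_right]
  rw [h1] at h
  have h2 : (s : ℂ) + ((c + 1 : ℝ) : ℂ) = ((s + c + 1 : ℝ) : ℂ) := by push_cast; ring
  have h3 : ((s + c + 1 : ℝ) : ℂ) - 1 = ((s + c : ℝ) : ℂ) := by push_cast; ring
  rw [h2, h3, Complex.Gamma_ofReal, Complex.Gamma_ofReal, Complex.Gamma_ofReal,
    ← Complex.ofReal_cpow hy.le] at h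
  exact_mod_cast h

/-- The `l`-fold convolution power of `z ^ (s - 1) dz` on the positive half-line. -/
theorem convPow_powMeasure_Ioi {s : ℝ} (hs : 0 < s) (l : ℕ) {y : ℝ} (hy : 0 < y) :
    (convPow (powMeasure (Set.Ioi 0) s) l).real (Set.Iic y) =
      Real.Gamma s ^ l * y ^ (s * l) / Real.Gamma (s * l + 1) := by
  have ha := isLocFiniteNonneg_powMeasure_Ioi hs
  induction l generalizing y with
  | zero => simp [convPow, measureReal_def, hy.le]
  | succ l ih =>
    rw [convPow, (ha.convPow l).real_conv_Iic, integral_powMeasure measurableSet_Ioi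
      Set.Ioi_subset_Ici_self]
    -- For `z > y` the half-line `Set.Iic (y - z)` is negative and carries no mass.
    have h1 : ∫ z in Set.Ioi 0, z ^ (s - 1) *
          (convPow (powMeasure (Set.Ioi 0) s) l).real (Set.Iic (y - z)) =
        ∫ z in Set.Ioo 0 y, z ^ (s - 1) *
          (convPow (powMeasure (Set.Ioi 0) s) l).real (Set.Iic (y - z)) := by
      rw [← integral_Ioc_eq_integral_Ioo]
      refine setIntegral_eq_of_subset_of_forall_sdiff_eq_zero measurableSet_Ioi
        (fun z hz => hz.1) fun z hz => ?_
      have hzy : y - z < 0 := by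
        have h1 := hz.1
        have h2 := hz.2
        simp only [Set.mem_Ioi, Set.mem_Ioc, not_and, not_le] at h1 h2
        linarith [h2 h1]
      rw [measureReal_def, measure_mono_null (fun x hx => ?_) (ha.convPow l).Iio_zero]
      · simp
      · simp only [Set.mem_Iic, Set.mem_Iio] at *
        linarith
    have h2 : ∫ z in Set.Ioo 0 y, z ^ (s - 1) *
          (convPow (powMeasure (Set.Ioi 0) s) l).real (Set.Iic (y - z)) =
        Real.Gamma s ^ l / Real.Gamma (s * l + 1) *
          ∫ z in Set.Ioo 0 y, z ^ (s - 1) * (y - z) ^ (s * l) := by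
      rw [← integral_const_mul]
      refine setIntegral_congr_fun measurableSet_Ioo fun z hz => ?_
      rw [ih (by linarith [hz.2])]
      ring
    rw [h1, h2, integral_Ioo_rpow_mul_sub_rpow hs (by positivity) hy]
    have : Real.Gamma (s * l + 1) ≠ 0 := (Real.Gamma_pos_of_pos (by positivity)).ne'
    rw [show s + s * (l : ℝ) = s * ((l + 1 : ℕ) : ℝ) by push_cast; ring]
    field_simp
    ring

/-- Bounded support is what makes `w / y < 1` when `y > j`, so that the binomial series in `w / y`
converges. -/
theorem ae_convPow_powMeasure_Ioo {s : ℝ} (j : ℕ) :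
    ∀ᵐ w ∂(convPow (powMeasure (Set.Ioo 0 1) s) j), w ∈ Set.Icc (0 : ℝ) j := by
  rw [ae_iff, show {w : ℝ | w ∉ Set.Icc (0 : ℝ) j} = (Set.Icc (0 : ℝ) j)ᶜ from rfl]
  induction j with
  | zero => simp [convPow]
  | succ j ih =>
    rw [convPow, ← lintegral_indicator_one measurableSet_Icc.compl,
      Measure.lintegral_conv (by measurability)]
    apply lintegral_eq_zero_of_ae_eq_zero
    filter_upwards [ae_powMeasure_mem measurableSet_Ioo s] with x hx
    apply lintegral_eq_zero_of_ae_eq_zero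
    have : ∀ᵐ w ∂(convPow (powMeasure (Set.Ioo 0 1) s) j), w ∈ Set.Icc (0 : ℝ) j := ih
    filter_upwards [this] with w hw
    have : x + w ∈ Set.Icc (0 : ℝ) ((j + 1 : ℕ) : ℝ) := by
      push_cast
      exact ⟨by linarith [hx.1, hw.1], by linarith [hx.2, hw.2]⟩
    simpa using this

theorem isFiniteMeasure_convPow_powMeasure_Ioo {s : ℝ} (hs : 0 < s) (j : ℕ) :
    IsFiniteMeasure (convPow (powMeasure (Set.Ioo 0 1) s) j) := by
  refine ⟨?_⟩
  rw [measure_congr (t := Set.Iic (j : ℝ))]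
  · exact ((isLocFiniteNonneg_powMeasure_Ioo hs).convPow j).Iic_lt_top j
  · filter_upwards [ae_convPow_powMeasure_Ioo (s := s) j] with w hw
    exact propext ⟨fun _ => hw.2, fun _ => trivial⟩

theorem integrable_pow_convPow_powMeasure_Ioo {s : ℝ} (hs : 0 < s) (j m : ℕ) :
    Integrable (fun w : ℝ => w ^ m / m !) (convPow (powMeasure (Set.Ioo 0 1) s) j) := by
  have := isFiniteMeasure_convPow_powMeasure_Ioo hs j
  refine Integrable.of_bound (by fun_prop) ((j : ℝ) ^ m / m !) ?_
  filter_upwards [ae_convPow_powMeasure_Ioo (s := s) j] with w hw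
  rw [Real.norm_of_nonneg (div_nonneg (pow_nonneg hw.1 _) (by positivity))]
  gcongr
  · exact hw.1
  · exact hw.2

/-- The exponential generating function of the moments of `z ^ (s - 1) dz` on `(0, 1)`. -/
def momentSeries (s : ℝ) : PowerSeries ℝ := PowerSeries.mk fun k => 1 / (k ! * (k + s))

theorem integral_pow_powMeasure_Ioo {s : ℝ} (hs : 0 < s) (m : ℕ) :
    ∫ w, w ^ m / (m ! : ℝ) ∂(powMeasure (Set.Ioo 0 1) s) = PowerSeries.coeff m (momentSeries s) := by
  rw [integral_powMeasure measurableSet_Ioo (fun x hx => hx.1.le), momentSeries,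
    PowerSeries.coeff_mk]
  have h1 : ∫ z in Set.Ioo (0 : ℝ) 1, z ^ (s - 1) * (z ^ m / m !) =
      1 / m ! * ∫ z in (0 : ℝ)..1, z ^ (m + s - 1) := by
    rw [intervalIntegral.integral_of_le zero_le_one, integral_Ioc_eq_integral_Ioo,
      ← integral_const_mul]
    refine setIntegral_congr_fun measurableSet_Ioo fun z hz => ?_
    rw [show (m : ℝ) + s - 1 = (s - 1) + m by ring, Real.rpow_add hz.1, Real.rpow_natCast]
    ring
  rw [h1, integral_rpow (Or.inl (by linarith [(Nat.cast_nonneg m : (0 : ℝ) ≤ m)])),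
    sub_add_cancel, Real.one_rpow, Real.zero_rpow (by positivity)]
  field_simp
  ring

/-- In divided powers the binomial theorem turns convolution into the Cauchy product, so exponential
moment generating series multiply. -/
theorem integral_pow_convPow_powMeasure_Ioo {s : ℝ} (hs : 0 < s) (j m : ℕ) :
    ∫ w, w ^ m / (m ! : ℝ) ∂(convPow (powMeasure (Set.Ioo 0 1) s) j) =
      PowerSeries.coeff m (momentSeries s ^ j) := by
  induction j generalizing m with
  | zero =>
    rw [convPow, integral_dirac, pow_zero, PowerSeries.coeff_one]
    rcases m with _ | m <;> simp
  | succ j ih =>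
    have hint := integrable_pow_convPow_powMeasure_Ioo hs (j + 1) m
    rw [convPow] at hint ⊢
    rw [integral_conv hint, pow_succ', PowerSeries.coeff_mul]
    have h1 (x : ℝ) : ∫ w, (x + w) ^ m / (m ! : ℝ) ∂(convPow (powMeasure (Set.Ioo 0 1) s) j) =
        ∑ p ∈ Finset.HasAntidiagonal.antidiagonal m, (x ^ p.1 / p.1 !) *
          PowerSeries.coeff p.2 (momentSeries s ^ j) := by
      simp_rw [add_pow_div_factorial]
      rw [integral_finsetSum _ fun p _ =>
        (integrable_pow_convPow_powMeasure_Ioo hs j p.2).const_mul _]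
      refine Finset.sum_congr rfl fun p _ => ?_
      rw [integral_const_mul, ih]
    simp_rw [h1]
    have hi (k : ℕ) : Integrable (fun w : ℝ => w ^ k / k !) (powMeasure (Set.Ioo 0 1) s) := by
      simpa [convPow] using integrable_pow_convPow_powMeasure_Ioo hs 1 k
    rw [integral_finsetSum _ fun p _ => (hi p.1).mul_const _]
    refine Finset.sum_congr rfl fun p _ => ?_
    rw [integral_mul_const, integral_pow_powMeasure_Ioo hs]

end powMeasure

/-- Integrate the explicit distribution function of the `Ioi` part at `y - w` over the bounded part
`w`, pull out `y ^ (s * l)`, expand `(1 - w / y) ^ (s * l)` and integrate termwise; the moments of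
`w` are the power-series coefficients. -/
theorem convPow_Ioo_conv_convPow_Ioi {s : ℝ} (hs : 0 < s) (j l : ℕ) {y : ℝ} (hy : (j : ℝ) < y) :
    (convPow (powMeasure (Set.Ioo 0 1) s) j ∗ convPow (powMeasure (Set.Ioi 0) s) l).real
        (Set.Iic y) =
      Real.Gamma s ^ l * y ^ (s * l) / Real.Gamma (s * l + 1) *
        ∑' m : ℕ, rising (-(s * l)) m * PowerSeries.coeff m (momentSeries s ^ j) * y⁻¹ ^ m := by
  have ha := isLocFiniteNonneg_powMeasure_Ioi hs
  have := isFiniteMeasure_convPow_powMeasure_Ioo hs j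
  have hy0 : 0 < y := (Nat.cast_nonneg j).trans_lt hy
  have hae := ae_convPow_powMeasure_Ioo (s := s) j
  rw [(ha.convPow l).real_conv_Iic]
  set ν := convPow (powMeasure (Set.Ioo 0 1) s) j
  set c := s * (l : ℝ)
  have hc : 0 ≤ c := by positivity
  have h1 : ∫ w, (convPow (powMeasure (Set.Ioi 0) s) l).real (Set.Iic (y - w)) ∂ν =
      Real.Gamma s ^ l * y ^ c / Real.Gamma (c + 1) * ∫ w, (1 - w / y) ^ c ∂ν := by
    rw [← integral_const_mul]
    refine integral_congr_ae ?_
    filter_upwards [hae] with w hw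
    have hw' : 0 < y - w := by linarith [hw.2]
    rw [convPow_powMeasure_Ioi hs l hw',
      show y - w = y * (1 - w / y) by field_simp, Real.mul_rpow hy0.le]
    · ring
    · rw [sub_nonneg, div_le_one hy0]; linarith [hw.2]
  have hq0 : 0 ≤ (j : ℝ) / y := by positivity
  have hq1 : (j : ℝ) / y < 1 := (div_lt_one hy0).2 hy
  have h2 : HasSum (fun m : ℕ => ∫ w, rising (-c) m / m ! * (w / y) ^ m ∂ν)
      (∫ w, (1 - w / y) ^ c ∂ν) := by
    -- The majorant is the series of `(1 - j / y) ^ (-c)`, convergent since `j < y`.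
    have hbound (m : ℕ) : ∀ᵐ w ∂ν, ‖rising (-c) m / m ! * (w / y) ^ m‖ ≤
        rising c m / m ! * ((j : ℝ) / y) ^ m := by
      filter_upwards [hae] with w hw
      have hwy : 0 ≤ w / y := div_nonneg hw.1 hy0.le
      rw [norm_mul, norm_div, norm_pow, Real.norm_of_nonneg hwy, Real.norm_natCast]
      have hle := norm_rising_le (-c) m
      rw [norm_neg, Real.norm_of_nonneg hc] at hle
      gcongr
      · exact div_nonneg (rising_nonneg hc m) (by positivity)
      · exact hw.2
    have hint (m : ℕ) : Integrable (fun w : ℝ => rising (-c) m / m ! * (w / y) ^ m) ν :=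
      Integrable.of_bound (by fun_prop) _ (hbound m)
    have key := hasSum_integral_of_summable_integral_norm
      (F := fun (m : ℕ) (w : ℝ) => rising (-c) m / m ! * (w / y) ^ m) (μ := ν) hint ?_
    · have e : ∫ w, (1 - w / y) ^ c ∂ν = ∫ w, ∑' m : ℕ, rising (-c) m / m ! * (w / y) ^ m ∂ν := by
        refine integral_congr_ae ?_
        filter_upwards [hae] with w hw
        have hwy : 0 ≤ w / y := div_nonneg hw.1 hy0.le
        have hlt : w / y < 1 := (div_lt_one hy0).2 (hw.2.trans_lt hy)
        rw [(hasSum_rising (-c) (x := w / y) (by rwa [abs_of_nonneg hwy])).tsum_eq, neg_neg]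
      rw [e]
      exact key
    · refine Summable.of_nonneg_of_le (fun m => integral_nonneg fun _ => norm_nonneg _) (fun m => ?_)
        ((summable_rising (c := c) hq0 hq1).mul_right (ν.real Set.univ))
      calc ∫ w, ‖rising (-c) m / m ! * (w / y) ^ m‖ ∂ν
          ≤ ∫ w, rising c m / m ! * ((j : ℝ) / y) ^ m ∂ν :=
            integral_mono_ae (hint m).norm (integrable_const _) (hbound m)
        _ = _ := by rw [integral_const, smul_eq_mul, mul_comm]
  rw [h1, ← h2.tsum_eq]
  congr 1
  refine tsum_congr fun m => ?_
  rw [← integral_pow_convPow_powMeasure_Ioo hs j m, ← integral_const_mul, ← integral_mul_const]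
  refine integral_congr_ae (Filter.Eventually.of_forall fun w => ?_)
  simp only
  rw [div_pow, inv_pow]
  ring

/-! ### The Pareto series for complex exponents -/

/-- The power series whose powers generate the coefficients `A_{i,j}`. -/
def paretoSeries {F : Type*} [Field F] (δ : F) : PowerSeries F :=
  PowerSeries.mk fun k => if k = 0 then 1 else δ / ((δ - k) * k !)

/-- At `δ = -s` the quotient `δ / (δ - k)` becomes `s / (s + k)`. This links the moments, available
for `s > 0`, to a series that makes sense for all `Re δ < 1`. -/
theorem paretoSeries_neg {s : ℝ} (hs : 0 < s) :
    paretoSeries (-s) = PowerSeries.C s * momentSeries s := by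
  ext k
  rw [paretoSeries, momentSeries, PowerSeries.coeff_mk, PowerSeries.coeff_C_mul,
    PowerSeries.coeff_mk]
  split_ifs with hk
  · subst hk; simp; field_simp
  · have h1 : -s - (k : ℝ) ≠ 0 := by
      have : (0 : ℝ) ≤ k := by positivity
      linarith
    field_simp
    ring

theorem ofReal_coeff_paretoSeries_pow (δ : ℝ) (j m : ℕ) :
    ((PowerSeries.coeff m (paretoSeries δ ^ j) : ℝ) : ℂ) =
      PowerSeries.coeff m (paretoSeries (δ : ℂ) ^ j) := by
  have : paretoSeries (δ : ℂ) = PowerSeries.map Complex.ofRealHom (paretoSeries δ) := by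
    ext k
    rw [PowerSeries.coeff_map, paretoSeries, paretoSeries, PowerSeries.coeff_mk,
      PowerSeries.coeff_mk]
    split_ifs <;> simp
  rw [this, ← map_pow, PowerSeries.coeff_map]
  rfl

/-- The series is majorised by `C e^X`, whose `j`-th power is `C^j e^(jX)`. -/
theorem norm_coeff_pow_le {𝕜 : Type*} [RCLike 𝕜] {f : PowerSeries 𝕜} {C : ℝ}
    (hf : ∀ k, ‖PowerSeries.coeff k f‖ ≤ C / k !) (j m : ℕ) :
    ‖PowerSeries.coeff m (f ^ j)‖ ≤ C ^ j * ((j : ℝ) ^ m / m !) := by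
  have hC : 0 ≤ C := by simpa using (norm_nonneg _).trans (hf 0)
  induction j generalizing m with
  | zero =>
    rw [pow_zero, PowerSeries.coeff_one]
    rcases m with _ | m <;> simp
  | succ j ih =>
    rw [pow_succ', PowerSeries.coeff_mul, Nat.cast_succ, add_comm (j : ℝ) 1,
      add_pow_div_factorial, Finset.mul_sum]
    refine (norm_sum_le _ _).trans (Finset.sum_le_sum fun p _ => ?_)
    rw [norm_mul]
    calc _ ≤ C / p.1 ! * (C ^ j * ((j : ℝ) ^ p.2 / p.2 !)) := by
          gcongr
          · exact hf _
          · exact ih _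
      _ = _ := by rw [one_pow]; ring

/-- For `k ≥ 1` the distance from `δ` to the pole `k` is at least `k - Re δ ≥ η`. -/
theorem norm_coeff_paretoSeries_le {R η : ℝ} (hη : 0 < η) {δ : ℂ} (hR : ‖δ‖ ≤ R)
    (hδ : δ.re ≤ 1 - η) (k : ℕ) :
    ‖PowerSeries.coeff k (paretoSeries δ)‖ ≤ max 1 (R / η) / k ! := by
  rw [paretoSeries, PowerSeries.coeff_mk]
  split_ifs with hk
  · subst hk; simp
  · rw [← div_div, norm_div, Complex.norm_natCast]
    gcongr
    rw [norm_div]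
    refine le_max_of_le_right (div_le_div₀ ((norm_nonneg _).trans hR) hR hη ?_)
    have h1 : (1 : ℝ) ≤ k := by exact_mod_cast Nat.one_le_iff_ne_zero.2 hk
    have h2 := Complex.abs_re_le_norm (δ - k)
    rw [Complex.sub_re, Complex.natCast_re] at h2
    have h3 := neg_abs_le (δ.re - k)
    linarith

/-- The series in the distribution function of a sum of Pareto variables, for complex exponents. -/
def paretoSum (y : ℝ) (j p : ℕ) (δ : ℂ) : ℂ :=
  ∑' m : ℕ, rising (δ * p) m * PowerSeries.coeff m (paretoSeries δ ^ j) * (y : ℂ)⁻¹ ^ m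

/-- The distribution function at `y` of the sum of `K` Pareto variables, for complex exponents. -/
def paretoFormula (K : ℕ) (y : ℝ) (δ : ℂ) : ℂ :=
  ∑ p ∈ Finset.range (K + 1), (K.choose p : ℂ) * (-Complex.Gamma (1 - δ)) ^ p *
    (y : ℂ) ^ (-(δ * p)) * (Complex.Gamma (1 - δ * p))⁻¹ * paretoSum y (K - p) p δ

/-- The bound depends on `δ` only through `R` and `η`: it is the Weierstrass majorant for local
uniform convergence in `δ`. -/
theorem norm_paretoSum_term_le {R η : ℝ} (hη : 0 < η) {δ : ℂ} (hR : ‖δ‖ ≤ R)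
    (hδ : δ.re ≤ 1 - η) {y : ℝ} (hy : 0 < y) (j p m : ℕ) :
    ‖rising (δ * p) m * PowerSeries.coeff m (paretoSeries δ ^ j) * (y : ℂ)⁻¹ ^ m‖ ≤
      max 1 (R / η) ^ j * (rising (R * p) m / m ! * ((j : ℝ) / y) ^ m) := by
  have h1 : ‖rising (δ * p) m‖ ≤ rising (R * p) m := by
    refine (norm_rising_le _ _).trans (rising_mono (norm_nonneg _) ?_ m)
    rw [norm_mul, Complex.norm_natCast]
    gcongr
  have h2 := norm_coeff_pow_le (norm_coeff_paretoSeries_le hη hR hδ) j m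
  rw [norm_mul, norm_mul, norm_pow, norm_inv, Complex.norm_real, Real.norm_of_nonneg hy.le]
  calc _ ≤ rising (R * p) m * (max 1 (R / η) ^ j * ((j : ℝ) ^ m / m !)) * y⁻¹ ^ m := by
        gcongr
        exact rising_nonneg (mul_nonneg ((norm_nonneg _).trans hR) (by positivity)) m
    _ = _ := by rw [div_pow, inv_pow]; ring

theorem differentiableAt_rising (p m : ℕ) (δ : ℂ) :
    DifferentiableAt ℂ (fun δ : ℂ => rising (δ * p) m) δ := by
  unfold rising
  fun_prop

/-- The poles are at the integers `k ≥ 1` only. The apparent singularity at `δ = 0` is absent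
because the constant coefficient is set to `1`, the value of `δ / δ` elsewhere. -/
theorem differentiableAt_coeff_paretoSeries (j m : ℕ) {δ : ℂ} (hδ : δ.re < 1) :
    DifferentiableAt ℂ (fun δ : ℂ => PowerSeries.coeff m (paretoSeries δ ^ j)) δ := by
  induction j generalizing m with
  | zero => simp
  | succ j ih =>
    simp only [pow_succ', PowerSeries.coeff_mul]
    refine DifferentiableAt.fun_sum fun p _ => DifferentiableAt.mul ?_ (ih _)
    simp only [paretoSeries, PowerSeries.coeff_mk]
    split_ifs with hk
    · fun_prop
    · refine DifferentiableAt.div (by fun_prop) (by fun_prop) ?_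
      refine mul_ne_zero (fun h => ?_) (by exact_mod_cast Nat.factorial_ne_zero _)
      have h1 : (1 : ℝ) ≤ (p.1 : ℝ) := by exact_mod_cast Nat.one_le_iff_ne_zero.2 hk
      have := congrArg Complex.re (sub_eq_zero.1 h)
      rw [Complex.natCast_re] at this
      linarith

theorem differentiableAt_paretoSum {y : ℝ} {j : ℕ} (hy : (j : ℝ) < y) (p : ℕ) {δ : ℂ}
    (hδ : δ.re < 1) : DifferentiableAt ℂ (paretoSum y j p) δ := by
  have hy0 : 0 < y := (Nat.cast_nonneg j).trans_lt hy
  obtain ⟨η, hη, hη'⟩ : ∃ η : ℝ, 0 < η ∧ δ.re < 1 - η := ⟨(1 - δ.re) / 2, by linarith, by linarith⟩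
  -- A neighbourhood of `δ` on which the majorant holds with `R = ‖δ‖ + 1` and the same `η`.
  let U : Set ℂ := {z | ‖z‖ < ‖δ‖ + 1 ∧ z.re < 1 - η}
  have hU : IsOpen U := (isOpen_lt continuous_norm continuous_const).inter
    (isOpen_lt Complex.continuous_re continuous_const)
  have hδU : δ ∈ U := ⟨by linarith, hη'⟩
  refine DifferentiableOn.differentiableAt (s := U) ?_ (hU.mem_nhds hδU)
  refine Complex.differentiableOn_tsum_of_summable_norm (u := fun m : ℕ =>
    max 1 ((‖δ‖ + 1) / η) ^ j * (rising ((‖δ‖ + 1) * p) m / m ! * ((j : ℝ) / y) ^ m))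
    ((summable_rising (by positivity) ((div_lt_one hy0).2 hy)).mul_left _) (fun m z hz => ?_) hU
    fun m z hz => norm_paretoSum_term_le hη hz.1.le hz.2.le hy0 j p m
  refine DifferentiableAt.differentiableWithinAt ?_
  exact ((differentiableAt_rising p m z).mul
    (differentiableAt_coeff_paretoSeries j m (by linarith [hz.2]))).mul_const _

theorem differentiableAt_paretoFormula {K : ℕ} {y : ℝ} (hy : (K : ℝ) < y) {δ : ℂ}
    (hδ : δ.re < 1) : DifferentiableAt ℂ (paretoFormula K y) δ := by
  have hy0 : 0 < y := (Nat.cast_nonneg K).trans_lt hy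
  refine DifferentiableAt.fun_sum fun p hp => ?_
  have hsub : ((K - p : ℕ) : ℝ) < y := lt_of_le_of_lt (by exact_mod_cast Nat.sub_le K p) hy
  refine DifferentiableAt.mul (DifferentiableAt.mul (DifferentiableAt.mul
    (DifferentiableAt.mul (by fun_prop) (DifferentiableAt.pow (DifferentiableAt.neg ?_) _)) ?_) ?_)
    (differentiableAt_paretoSum hsub p hδ)
  · have : DifferentiableAt ℂ Complex.Gamma (1 - δ) := by
      refine Complex.differentiableAt_Gamma _ fun m h => ?_
      have := congrArg Complex.re h
      simp only [Complex.sub_re, Complex.one_re, Complex.neg_re, Complex.natCast_re] at this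
      linarith [(Nat.cast_nonneg m : (0 : ℝ) ≤ m)]
    exact this.comp δ (by fun_prop)
  · refine DifferentiableAt.const_cpow (by fun_prop) (Or.inl ?_)
    exact_mod_cast hy0.ne'
  · exact (Complex.differentiable_one_div_Gamma _).comp δ (by fun_prop)

/-- Binomial inversion with `a`, `b`, `e` the measures on `(0, ∞)`, `(0, 1)`, `[1, ∞)`. The
prefactor `(-s) ^ K` is split: `s ^ q` turns moments into `paretoSeries`, and `s ^ p` turns `Γ(s)`
into `Γ(1 + s) = Γ(1 - δ)`. -/
theorem paretoFormula_neg {s : ℝ} (hs : 0 < s) {K : ℕ} {y : ℝ} (hy : (K : ℝ) < y) :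
    (((-s) ^ K * (convPow (powMeasure (Set.Ici 1) s) K).real (Set.Iic y) : ℝ) : ℂ) =
      paretoFormula K y ((-s : ℝ) : ℂ) := by
  have hy0 : 0 < y := (Nat.cast_nonneg K).trans_lt hy
  have h := IsLocFiniteNonneg.convPow_real_Iic (isLocFiniteNonneg_powMeasure_Ioo hs)
    (isLocFiniteNonneg_powMeasure_Ici s) (powMeasure_Ioi_eq_add s) K 0 0 y
  simp only [convPow, Measure.conv_dirac_zero, zero_add] at h
  rw [h, paretoFormula, Finset.mul_sum, Complex.ofReal_sum]
  refine Finset.sum_congr rfl fun p hp => ?_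
  obtain ⟨q, rfl⟩ : ∃ q, K = p + q := ⟨K - p, by have := Finset.mem_range.1 hp; omega⟩
  have hsub : ((p + q - p : ℕ) : ℝ) < y := lt_of_le_of_lt (by exact_mod_cast Nat.sub_le _ p) hy
  rw [convPow_Ioo_conv_convPow_Ioi hs _ _ hsub, Nat.add_sub_cancel_left]
  have h1 : paretoSum y q p ((-s : ℝ) : ℂ) =
      ((s ^ q * ∑' m : ℕ, rising (-(s * p)) m * PowerSeries.coeff m (momentSeries s ^ q) *
        y⁻¹ ^ m : ℝ) : ℂ) := by
    rw [paretoSum, ← tsum_mul_left, Complex.ofReal_tsum]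
    refine tsum_congr fun m => ?_
    rw [← ofReal_coeff_paretoSeries_pow, paretoSeries_neg hs, mul_pow, ← map_pow,
      PowerSeries.coeff_C_mul]
    push_cast [ofReal_rising]
    ring_nf
  have h2 : Complex.Gamma (1 - ((-s : ℝ) : ℂ)) = ((s * Real.Gamma s : ℝ) : ℂ) := by
    rw [← Real.Gamma_add_one hs.ne', ← Complex.Gamma_ofReal]; push_cast; ring_nf
  have h3 : Complex.Gamma (1 - ((-s : ℝ) : ℂ) * p) = ((Real.Gamma (s * p + 1) : ℝ) : ℂ) := by
    rw [← Complex.Gamma_ofReal]; push_cast; ring_nf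
  have h4 : (y : ℂ) ^ (-(((-s : ℝ) : ℂ) * p)) = ((y ^ (s * p) : ℝ) : ℂ) := by
    rw [Complex.ofReal_cpow hy0.le]; push_cast; ring_nf
  rw [h1, h2, h3, h4]
  push_cast
  generalize (∑' m : ℕ, ((rising (-(s * p)) m : ℝ) : ℂ) *
    ((PowerSeries.coeff m (momentSeries s ^ q) : ℝ) : ℂ) * (y : ℂ)⁻¹ ^ m) = T
  -- The sign of the binomial inversion cancels that of `(-s) ^ q`; the remaining `(-1) ^ p` is the
  -- one in `(-Γ(1 - δ)) ^ p`.
  have h5 : ((-1 : ℂ) ^ q) * (-1) ^ q = 1 := by rw [← mul_pow]; simp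
  rw [pow_add, neg_pow (s : ℂ) p, neg_pow (s : ℂ) q, neg_pow ((s : ℂ) * _) p, mul_pow]
  linear_combination ((-1 : ℂ) ^ p * (s : ℂ) ^ p * (s : ℂ) ^ q * ((p + q).choose p : ℂ) *
    ((Real.Gamma s : ℝ) : ℂ) ^ p * ((y ^ (s * p) : ℝ) : ℂ) *
    ((Real.Gamma (s * p + 1) : ℝ) : ℂ)⁻¹ * T) * h5

/-! ### Analytic continuation in the exponent -/

/-- Lebesgue measure on `[1, ∞)`, transported to the graph of the logarithm. -/
def logGraph : Measure (ℝ × ℝ) := (volume.restrict (Set.Ici (1 : ℝ))).map fun z => (z, Real.log z)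

instance : SFinite logGraph := by rw [logGraph]; infer_instance

/-- Since `z^(s-1) = e^((s-1) log z)`, carrying `log z` as a second coordinate turns the dependence
on `s` into an exponential tilt. The logarithms add under convolution, so the tilt survives all
convolution powers. -/
theorem powMeasure_Ici_eq_map (s : ℝ) : powMeasure (Set.Ici 1) s =
    (logGraph.withDensity fun p => ENNReal.ofReal (Real.exp ((s - 1) * p.2))).map
      (AddMonoidHom.fst ℝ ℝ) := by
  have hm : Measurable (AddMonoidHom.fst ℝ ℝ) := measurable_fst
  have hl : Measurable fun z : ℝ => (z, Real.log z) := by fun_prop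
  refine Measure.ext_of_lintegral _ fun f hf => ?_
  have hf' : Measurable fun a : ℝ × ℝ => f (AddMonoidHom.fst ℝ ℝ a) := hf.comp hm
  rw [lintegral_map hf hm, powMeasure, logGraph,
    lintegral_withDensity_eq_lintegral_mul _ (by fun_prop) hf,
    lintegral_withDensity_eq_lintegral_mul _ (by fun_prop) hf',
    lintegral_map (Measurable.mul (by fun_prop) hf') hl]
  refine setLIntegral_congr_fun measurableSet_Ici fun z hz => ?_
  have hz0 : (0 : ℝ) < z := zero_lt_one.trans_le hz
  simp [Real.rpow_def_of_pos hz0, mul_comm]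

theorem convPow_powMeasure_Ici (s : ℝ) (K : ℕ) (y : ℝ) :
    convPow (powMeasure (Set.Ici 1) s) K (Set.Iic y) =
      ∫⁻ p in {p : ℝ × ℝ | p.1 ≤ y}, ENNReal.ofReal (Real.exp ((s - 1) * p.2))
        ∂(convPow logGraph K) := by
  have hm : Measurable (AddMonoidHom.fst ℝ ℝ) := measurable_fst
  have hg : Measurable fun p : ℝ × ℝ => ENNReal.ofReal (Real.exp ((s - 1) * p.2)) := by fun_prop
  rw [powMeasure_Ici_eq_map, convPow_map _ _ hm,
    convPow_withDensity hg (by simp) (fun p q => by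
      rw [← ENNReal.ofReal_mul (Real.exp_pos _).le, ← Real.exp_add]; simp [mul_add]),
    Measure.map_apply hm measurableSet_Iic, withDensity_apply _ (hm measurableSet_Iic)]
  rfl

/-- The measure whose moment generating function gives the `K`-fold convolution powers of
`z ^ (s - 1) dz` on `[1, ∞)`, evaluated at `(-∞, y]`, as functions of `s`. -/
def logMeasure (K : ℕ) (y : ℝ) : Measure (ℝ × ℝ) :=
  (convPow logGraph K).restrict {p : ℝ × ℝ | p.1 ≤ y}

/-- The integral is the mass of `Set.Iic y` for exponent `t + 1`, finite for every real `t`; hence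
the moment generating function is entire. -/
theorem integrable_exp_logMeasure (K : ℕ) (y t : ℝ) :
    Integrable (fun p : ℝ × ℝ => Real.exp (t * p.2)) (logMeasure K y) := by
  refine ⟨by fun_prop, ?_⟩
  rw [hasFiniteIntegral_iff_ofReal (Filter.Eventually.of_forall fun p => (Real.exp_pos _).le)]
  have h := convPow_powMeasure_Ici (t + 1) K y
  rw [add_sub_cancel_right] at h
  rw [logMeasure, ← h]
  exact ((isLocFiniteNonneg_powMeasure_Ici _).convPow K).Iic_lt_top y

theorem mgf_logMeasure (K : ℕ) (y t : ℝ) : mgf Prod.snd (logMeasure K y) t =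
    (convPow (powMeasure (Set.Ici 1) (t + 1)) K).real (Set.Iic y) := by
  rw [measureReal_def, convPow_powMeasure_Ici, add_sub_cancel_right, mgf,
    integral_eq_lintegral_of_nonneg_ae (Filter.Eventually.of_forall fun p => (Real.exp_pos _).le)
      (by fun_prop)]
  rfl

theorem differentiable_complexMGF_logMeasure (K : ℕ) (y : ℝ) :
    Differentiable ℂ (complexMGF Prod.snd (logMeasure K y)) := by
  have : integrableExpSet Prod.snd (logMeasure K y) = Set.univ :=
    Set.eq_univ_of_forall fun t => integrable_exp_logMeasure K y t
  intro z
  have hz : z.re ∈ interior (integrableExpSet Prod.snd (logMeasure K y)) := by simp [this]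
  exact (analyticAt_complexMGF hz).differentiableAt

theorem ofReal_convPow_powMeasure_Ici (K : ℕ) (y δ : ℝ) :
    ((δ ^ K * (convPow (powMeasure (Set.Ici 1) (-δ)) K).real (Set.Iic y) : ℝ) : ℂ) =
      (δ : ℂ) ^ K * complexMGF Prod.snd (logMeasure K y) (-δ - 1) := by
  have : (-(δ : ℂ) - 1) = ((-δ - 1 : ℝ) : ℂ) := by push_cast; ring
  rw [this, complexMGF_ofReal, mgf_logMeasure, sub_add_cancel]
  push_cast
  rfl

/-- Analytic continuation of `paretoFormula_neg` to all exponents below one. -/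
theorem ofReal_convPow_powMeasure_eq_paretoFormula {K : ℕ} {y : ℝ} (hy : (K : ℝ) < y) {δ : ℝ}
    (hδ : δ < 1) :
    ((δ ^ K * (convPow (powMeasure (Set.Ici 1) (-δ)) K).real (Set.Iic y) : ℝ) : ℂ) =
      paretoFormula K y δ := by
  let U : Set ℂ := {z | z.re < 1}
  have hUo : IsOpen U := isOpen_lt Complex.continuous_re continuous_const
  have hUc : IsPreconnected U := (convex_halfSpace_re_lt 1).isPreconnected
  let f : ℂ → ℂ := fun z => z ^ K * complexMGF Prod.snd (logMeasure K y) (-z - 1)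
  have hf : AnalyticOnNhd ℂ f U := by
    refine DifferentiableOn.analyticOnNhd (fun z _ => ?_) hUo
    refine DifferentiableAt.differentiableWithinAt (DifferentiableAt.mul (by fun_prop) ?_)
    exact (differentiable_complexMGF_logMeasure K y _).comp z (by fun_prop)
  have hg : AnalyticOnNhd ℂ (paretoFormula K y) U :=
    DifferentiableOn.analyticOnNhd
      (fun z hz => (differentiableAt_paretoFormula hy hz).differentiableWithinAt) hUo
  -- The two functions agree at all negative reals, which accumulate at `-1`.
  have hfreq : ∃ᶠ z in nhdsWithin (-1 : ℂ) {-1}ᶜ, f z = paretoFormula K y z := by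
    have ht : Filter.Tendsto (fun x : ℝ => (x : ℂ)) (nhdsWithin (-1 : ℝ) {-1}ᶜ)
        (nhdsWithin (-1 : ℂ) {-1}ᶜ) := by
      refine tendsto_nhdsWithin_of_tendsto_nhds_of_eventually_within _ ?_ ?_
      · have := (Complex.continuous_ofReal.tendsto (-1 : ℝ))
        push_cast at this
        exact this.mono_left nhdsWithin_le_nhds
      · filter_upwards [self_mem_nhdsWithin] with x hx
        simp only [Set.mem_compl_iff, Set.mem_singleton_iff] at hx ⊢
        exact fun h => hx (by exact_mod_cast h)
    refine ht.frequently (Filter.Eventually.frequently ?_)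
    have : ∀ᶠ x : ℝ in nhdsWithin (-1 : ℝ) {-1}ᶜ, x < 0 :=
      nhdsWithin_le_nhds (gt_mem_nhds (by norm_num))
    filter_upwards [this] with x hx
    have h := paretoFormula_neg (s := -x) (by linarith) hy
    rw [neg_neg] at h
    rw [← h, ofReal_convPow_powMeasure_Ici]
  have := hf.eqOn_of_preconnected_of_frequently_eq hg hUc (z₀ := -1) (by simp [U]) hfreq
    (show (δ : ℂ) ∈ U by simpa [U] using hδ)
  rw [ofReal_convPow_powMeasure_Ici, ← this]

/-! ### The coefficients `A_{i,j}` and the Pareto sum above `K` -/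

/-- The recursion for the coefficients of the powers of a power series. -/
theorem nat_mul_coeff_pow (f : PowerSeries ℝ) (hf0 : PowerSeries.coeff 0 f = 1) (i j : ℕ) :
    (j : ℝ) * PowerSeries.coeff j (f ^ i) = ∑ l ∈ Finset.Icc 1 j,
      ((l : ℝ) * ((i : ℝ) + 1) - j) * PowerSeries.coeff l f *
        PowerSeries.coeff (j - l) (f ^ i) := by
  -- The Euler operator multiplies the `n`-th coefficient by `n`; comparing coefficients in `f * θ
  -- (f ^ i) = i * θ f * f ^ i` gives the recursion.
  let θ : PowerSeries ℝ → PowerSeries ℝ := fun g => PowerSeries.X * PowerSeries.derivative ℝ g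
  have hθ (g : PowerSeries ℝ) (n : ℕ) : PowerSeries.coeff n (θ g) = n * PowerSeries.coeff n g := by
    rcases n with _ | n
    · simp [θ]
    · rw [show n + 1 = 1 + n by ring]
      simp only [θ, add_comm 1 n, PowerSeries.coeff_succ_X_mul, PowerSeries.coeff_derivative]
      push_cast
      ring
  have hmul : f * θ (f ^ i) = (i : PowerSeries ℝ) * (θ f * f ^ i) := by
    simp only [θ, Derivation.leibniz_pow]
    rcases i with _ | i
    · simp
    · simp only [Nat.add_sub_cancel, nsmul_eq_mul, smul_eq_mul, pow_succ]
      ring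
  have h := congrArg (PowerSeries.coeff j) hmul
  have hs (g : ℕ → ℝ) : ∑ k ∈ Finset.range j.succ, g k = g 0 + ∑ k ∈ Finset.Ico 1 (j + 1), g k := by
    rw [Finset.range_eq_Ico, Finset.sum_eq_sum_Ico_succ_bot (by omega)]
  rw [← nsmul_eq_mul, map_nsmul, PowerSeries.coeff_mul, PowerSeries.coeff_mul] at h
  simp only [hθ] at h
  rw [Finset.Nat.sum_antidiagonal_eq_sum_range_succ
      (fun a b => PowerSeries.coeff a f * (b * PowerSeries.coeff b (f ^ i))),
    Finset.Nat.sum_antidiagonal_eq_sum_range_succ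
      (fun a b => (a : ℝ) * PowerSeries.coeff a f * PowerSeries.coeff b (f ^ i)), hs, hs, hf0] at h
  simp only [nsmul_eq_mul, Nat.sub_zero, Nat.cast_zero, zero_mul, zero_add, one_mul] at h
  rw [← Finset.Ico_add_one_right_eq_Icc, ← sub_eq_zero]
  rw [← sub_eq_zero] at h
  rw [← h, Finset.mul_sum, add_sub_assoc, sub_eq_add_neg, ← Finset.sum_sub_distrib,
    ← Finset.sum_neg_distrib]
  congr 1
  refine Finset.sum_congr rfl fun l hl => ?_
  have hl' := Finset.mem_Ico.1 hl
  rw [Nat.cast_sub (by omega)]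
  ring

/-- The coefficients `A_{i,j}` of the recursion are those of the powers of `paretoSeries`. -/
theorem coeffA_eq_coeff {α : ℝ} (hα : 2 < α) (i j : ℕ) :
    coeffA α i j = PowerSeries.coeff j (paretoSeries (2 / α) ^ i) := by
  set f : PowerSeries ℝ := paretoSeries (2 / α) with hf
  have hf0 : PowerSeries.coeff 0 f = 1 := by simp [hf, paretoSeries]
  have hfl (l : ℕ) : PowerSeries.coeff l f = 2 / ((l ! : ℝ) * (2 - l * α)) := by
    rw [hf, paretoSeries, PowerSeries.coeff_mk]
    split_ifs with hl
    · subst hl; simp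
    · have h1 : (1 : ℝ) ≤ l := by exact_mod_cast Nat.one_le_iff_ne_zero.2 hl
      have h2 : 2 - l * α ≠ 0 := by nlinarith
      have : (l ! : ℝ) ≠ 0 := by positivity
      have : α ≠ 0 := by linarith
      field_simp
  induction j using Nat.strong_induction_on with
  | _ j ih =>
    rcases Nat.eq_zero_or_pos j with rfl | hj
    · rw [coeffA_zero, PowerSeries.coeff_zero_eq_constantCoeff_apply, map_pow,
        ← PowerSeries.coeff_zero_eq_constantCoeff_apply, hf0, one_pow]
    · have hj' : (j : ℝ) ≠ 0 := by positivity
      rw [coeffA_eq α i j hj, one_div, inv_mul_eq_iff_eq_mul₀ hj', nat_mul_coeff_pow f hf0]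
      refine Finset.sum_congr rfl fun l hl => ?_
      have hl' := Finset.mem_Icc.1 hl
      rw [ih (j - l) (by omega), hfl]

theorem paretoSum_zero {δ : ℝ} (y : ℝ) (j : ℕ) : paretoSum y j 0 (δ : ℂ) = 1 := by
  rw [paretoSum, tsum_eq_single 0 fun m hm => by simp [rising_zero_left hm]]
  have h0 : PowerSeries.constantCoeff (paretoSeries (δ : ℂ)) = 1 := by
    rw [← PowerSeries.coeff_zero_eq_constantCoeff_apply]; simp [paretoSeries]
  simp [rising_zero_right, h0]

/-- The `m`-th term of the series in the tail of a sum of Pareto variables. -/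
def paretoTerm (α : ℝ) (K l : ℕ) (y : ℝ) (m : ℕ) : ℝ :=
  coeffA α (K - l) m * Real.Gamma ((m : ℝ) + 2 / α * (l : ℝ)) * y ^ (-(m : ℝ) - 2 / α * (l : ℝ))

theorem paretoTerm_eq {α : ℝ} (hα : 2 < α) (K : ℕ) {l : ℕ} (hl : 1 ≤ l) {y : ℝ} (hy : 0 < y)
    (m : ℕ) : paretoTerm α K l y m = Real.Gamma (2 / α * l) * y ^ (-(2 / α * l)) *
      (rising (2 / α * l) m * PowerSeries.coeff m (paretoSeries (2 / α) ^ (K - l)) * y⁻¹ ^ m) := by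
  have hs : 0 < 2 / α * (l : ℝ) := by
    have : (0 : ℝ) < l := by exact_mod_cast hl
    have : 0 < α := by linarith
    positivity
  rw [paretoTerm, coeffA_eq_coeff hα, Gamma_nat_add hs, sub_eq_add_neg, Real.rpow_add hy,
    Real.rpow_neg hy.le (m : ℝ), Real.rpow_natCast, inv_pow]
  ring

/-- The endpoint `y = K` is included: `l ≥ 1` gives ratio `(K - l) / y < 1` there too. This is what
later allows domination by the value at `K`. -/
theorem summable_norm_paretoTerm {α : ℝ} (hα : 2 < α) {K l : ℕ} (hl : 1 ≤ l) (hlK : l ≤ K) {y : ℝ}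
    (hy : (K : ℝ) ≤ y) : Summable fun m => ‖paretoTerm α K l y m‖ := by
  have hl0 : (1 : ℝ) ≤ l := by exact_mod_cast hl
  have hlK0 : (l : ℝ) ≤ K := by exact_mod_cast hlK
  have hy0 : 0 < y := by linarith
  have hα0 : 0 < α := by linarith
  have hδ1 : 2 / α < 1 := (div_lt_one hα0).2 hα
  have hq : ((K - l : ℕ) : ℝ) / y < 1 := by
    rw [div_lt_one hy0, Nat.cast_sub hlK]; linarith
  have hs := (((summable_rising (c := 2 / α * l) (by positivity) hq).mul_left
    (max 1 (2 / α / (1 - 2 / α)) ^ (K - l))).mul_left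
      (Real.Gamma (2 / α * l) * y ^ (-(2 / α * l))))
  refine Summable.of_nonneg_of_le (fun _ => norm_nonneg _) (fun m => ?_) hs
  rw [paretoTerm_eq hα K hl hy0, norm_mul, Real.norm_of_nonneg (by positivity)]
  refine mul_le_mul_of_nonneg_left ?_ (by positivity)
  have h := norm_paretoSum_term_le (R := 2 / α) (η := 1 - 2 / α) (by linarith)
    (δ := ((2 / α : ℝ) : ℂ)) (by rw [Complex.norm_real, Real.norm_of_nonneg (by positivity)])
    (by simp [-Complex.ofReal_div]) hy0 (K - l) l m
  refine le_trans (le_of_eq ?_) h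
  rw [← ofReal_coeff_paretoSeries_pow, ← Complex.norm_real]
  push_cast [ofReal_rising]
  rfl

/-- The distribution function of a sum of `K` Pareto variables. -/
def paretoCDF (α : ℝ) (K : ℕ) (y : ℝ) : ℝ :=
  (2 / α) ^ K * (convPow (powMeasure (Set.Ici 1) (-(2 / α))) K).real (Set.Iic y)

/-- The term `p = 0` of `paretoFormula` at `δ = 2 / α` is the constant `1`. In the others the
reflection formula replaces `1 / Γ(1 - δ l)` by `Γ(δ l) sin(π δ l) / π`, and `Γ(δ l)` times the
rising factorial is `Γ(m + δ l)`. -/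
theorem paretoCDF_eq {α : ℝ} (hα : 2 < α) {K : ℕ} {y : ℝ} (hy : (K : ℝ) < y) :
    paretoCDF α K y = 1 + 1 / Real.pi * ∑ l ∈ Finset.Icc 1 K,
      (K.choose l : ℝ) * (-Real.Gamma (1 - 2 / α)) ^ l * Real.sin (2 * Real.pi * (l : ℝ) / α) *
        ∑' m : ℕ, paretoTerm α K l y m := by
  have hα0 : 0 < α := by linarith
  have hδ1 : 2 / α < 1 := (div_lt_one hα0).2 hα
  have hy0 : 0 < y := (Nat.cast_nonneg K).trans_lt hy
  have h := ofReal_convPow_powMeasure_eq_paretoFormula hy hδ1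
  apply Complex.ofReal_injective
  rw [paretoCDF, h, paretoFormula, Finset.range_eq_Ico,
    Finset.sum_eq_sum_Ico_succ_bot (by omega)]
  simp only [Nat.choose_zero_right, Nat.cast_zero, mul_zero, neg_zero, sub_zero,
    Complex.Gamma_one, Complex.cpow_zero, pow_zero, paretoSum_zero, zero_add]
  push_cast
  simp only [inv_one, one_mul]
  congr 1
  rw [Finset.mul_sum, Finset.Ico_add_one_right_eq_Icc]
  refine Finset.sum_congr rfl fun l hl => ?_
  have hl' := Finset.mem_Icc.1 hl
  set s : ℝ := 2 / α * l with hs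
  have hs0 : 0 < s := by
    have : (0 : ℝ) < l := by exact_mod_cast hl'.1
    positivity
  have h1 : paretoSum y (K - l) l ((2 : ℂ) / α) = ((∑' m : ℕ, rising s m *
      PowerSeries.coeff m (paretoSeries (2 / α) ^ (K - l)) * y⁻¹ ^ m : ℝ) : ℂ) := by
    rw [paretoSum, Complex.ofReal_tsum]
    refine tsum_congr fun m => ?_
    push_cast [ofReal_coeff_paretoSeries_pow, ofReal_rising, hs]
    rfl
  have h2 : (Complex.Gamma (1 - 2 / (α : ℂ) * l))⁻¹ =
      ((Real.Gamma s * Real.sin (2 * Real.pi * l / α) / Real.pi : ℝ) : ℂ) := by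
    have e : (1 - 2 / (α : ℂ) * l) = ((1 - s : ℝ) : ℂ) := by push_cast [hs]; rfl
    rw [e, Complex.Gamma_ofReal, ← Complex.ofReal_inv]
    congr 1
    have hrefl := Real.Gamma_mul_Gamma_one_sub s
    have hsin : 2 * Real.pi * l / α = Real.pi * s := by rw [hs]; ring
    rw [hsin]
    have hΓ := (Real.Gamma_pos_of_pos hs0).ne'
    -- If the sine vanishes, `1 - s` is a pole, where `Real.Gamma` takes the value `0`, so both
    -- sides are `0`.
    rcases eq_or_ne (Real.sin (Real.pi * s)) 0 with h0 | h0
    · rw [h0, div_zero] at hrefl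
      rcases mul_eq_zero.1 hrefl with h' | h'
      · exact absurd h' hΓ
      · rw [h', h0]; simp
    · have : Real.Gamma (1 - s) = Real.pi / Real.sin (Real.pi * s) / Real.Gamma s := by
        rw [← hrefl]; field_simp
      rw [this]
      field_simp
  have h3 : Complex.Gamma (1 - 2 / (α : ℂ)) = ((Real.Gamma (1 - 2 / α) : ℝ) : ℂ) := by
    rw [← Complex.Gamma_ofReal]; push_cast; rfl
  have h4 : (y : ℂ) ^ (-(2 / (α : ℂ) * l)) = ((y ^ (-s) : ℝ) : ℂ) := by
    rw [Complex.ofReal_cpow hy0.le]; push_cast [hs]; rfl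
  have h5 : ∑' m : ℕ, ((paretoTerm α K l y m : ℝ) : ℂ) =
      ((Real.Gamma s * y ^ (-s) * ∑' m : ℕ, rising s m *
        PowerSeries.coeff m (paretoSeries (2 / α) ^ (K - l)) * y⁻¹ ^ m : ℝ) : ℂ) := by
    rw [← tsum_mul_left, Complex.ofReal_tsum]
    exact tsum_congr fun m => by rw [paretoTerm_eq hα K hl'.1 hy0]
  have h6 : Complex.sin (2 * Real.pi * l / α) = ((Real.sin (2 * Real.pi * l / α) : ℝ) : ℂ) := by
    push_cast; rfl
  rw [h1, h2, h3, h4, h5, h6]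
  push_cast
  ring

/-! ### Support of the Pareto sum, and Pareto variables from uniform ones -/

theorem ae_convPow_powMeasure_Ici (s : ℝ) (K : ℕ) :
    ∀ᵐ w ∂(convPow (powMeasure (Set.Ici 1) s) K), (K : ℝ) ≤ w := by
  rw [ae_iff, show {w : ℝ | ¬ (K : ℝ) ≤ w} = Set.Iio (K : ℝ) by ext; simp]
  induction K with
  | zero => simp [convPow]
  | succ K ih =>
    rw [convPow, ← lintegral_indicator_one measurableSet_Iio,
      Measure.lintegral_conv (by measurability)]
    apply lintegral_eq_zero_of_ae_eq_zero
    filter_upwards [ae_powMeasure_mem measurableSet_Ici s] with x hx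
    apply lintegral_eq_zero_of_ae_eq_zero
    have : ∀ᵐ w ∂(convPow (powMeasure (Set.Ici 1) s) K), (K : ℝ) ≤ w := by
      rw [ae_iff, show {w : ℝ | ¬ (K : ℝ) ≤ w} = Set.Iio (K : ℝ) by ext; simp]
      exact ih
    filter_upwards [this] with w hw
    have : x + w ∉ Set.Iio (((K + 1 : ℕ) : ℝ)) := by
      push_cast
      simp only [Set.mem_Iio, not_lt]
      linarith [show (1 : ℝ) ≤ x from hx]
    simpa using this

theorem paretoCDF_of_lt (α : ℝ) {K : ℕ} {y : ℝ} (hy : y < K) : paretoCDF α K y = 0 := by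
  have : convPow (powMeasure (Set.Ici 1) (-(2 / α))) K (Set.Iic y) = 0 := by
    refine measure_mono_null (fun w hw => ?_) (ae_iff.1 (ae_convPow_powMeasure_Ici (-(2 / α)) K))
    simp only [Set.mem_Iic, Set.mem_ofPred_eq, not_le] at *
    linarith
  simp [paretoCDF, measureReal_def, this]

/-- A negative power of a uniform variable is Pareto with index `2 / α`; the factor `t` is the
unnormalised mass of `(0, t)` and `2 / α` normalises the Pareto density. -/
theorem map_rpow_uniform {α t : ℝ} (hα : 0 < α) (ht : 0 < t) :
    (volume.restrict (Set.Ioo 0 t)).map (fun u : ℝ => (u / t) ^ (-(α / 2))) =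
      ENNReal.ofReal (t * (2 / α)) • powMeasure (Set.Ici 1) (-(2 / α)) := by
  have hf : Measurable fun u : ℝ => (u / t) ^ (-(α / 2)) := by fun_prop
  refine Measure.ext_of_Iic _ _ fun z => ?_
  rw [Measure.map_apply hf measurableSet_Iic, Measure.restrict_apply (hf measurableSet_Iic),
    Measure.smul_apply, smul_eq_mul, powMeasure_apply _ _ measurableSet_Iic]
  rcases lt_or_ge z 1 with hz | hz
  · have e1 : (fun u : ℝ => (u / t) ^ (-(α / 2))) ⁻¹' Set.Iic z ∩ Set.Ioo 0 t = ∅ := by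
      ext u
      simp only [Set.mem_inter_iff, Set.mem_preimage, Set.mem_Iic, Set.mem_Ioo,
        Set.mem_empty_iff_false, iff_false, not_and]
      intro h1 h2 h3
      have : 1 ≤ (u / t) ^ (-(α / 2)) :=
        Real.one_le_rpow_of_pos_of_le_one_of_nonpos (by positivity)
          ((div_le_one ht).2 h3.le) (by linarith)
      linarith
    have e2 : Set.Iic z ∩ Set.Ici 1 = ∅ := by
      ext u; simp only [Set.mem_inter_iff, Set.mem_Iic, Set.mem_Ici, Set.mem_empty_iff_false,
        iff_false, not_and, not_le]
      intro h; linarith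
    simp [e1, e2]
  · have hz0 : 0 < z := by linarith
    have hzpos : 0 < z ^ (-(2 / α)) := Real.rpow_pos_of_pos hz0 _
    have e1 : (fun u : ℝ => (u / t) ^ (-(α / 2))) ⁻¹' Set.Iic z ∩ Set.Ioo 0 t =
        Set.Ico (t * z ^ (-(2 / α))) t := by
      ext u
      simp only [Set.mem_inter_iff, Set.mem_preimage, Set.mem_Iic, Set.mem_Ioo, Set.mem_Ico]
      have key (hu : 0 < u) : (u / t) ^ (-(α / 2)) ≤ z ↔ t * z ^ (-(2 / α)) ≤ u := by
        have hut : 0 < u / t := by positivity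
        have e : ((z ^ (-(2 / α))) ^ (-(α / 2))) = z := by
          rw [← Real.rpow_mul hz0.le]
          have : -(2 / α) * -(α / 2) = 1 := by field_simp
          rw [this, Real.rpow_one]
        nth_rewrite 1 [← e]
        rw [Real.rpow_le_rpow_iff_of_neg hut hzpos (by linarith), le_div_iff₀ ht, mul_comm]
      constructor
      · rintro ⟨h1, h2, h3⟩
        exact ⟨(key h2).1 h1, h3⟩
      · rintro ⟨h1, h2⟩
        have hu : 0 < u := lt_of_lt_of_le (by positivity) h1
        exact ⟨(key hu).2 h1, hu, h2⟩
    have e2 : Set.Iic z ∩ Set.Ici 1 = Set.Icc 1 z := by ext; simp [and_comm]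
    have hd : 0 < 2 / α := by positivity
    have e3 : ∫ u in Set.Icc 1 z, u ^ (-(2 / α) - 1) = (1 - z ^ (-(2 / α))) / (2 / α) := by
      rw [integral_Icc_eq_integral_Ioc, ← intervalIntegral.integral_of_le hz,
        integral_rpow (Or.inr ⟨by linarith, by rw [Set.uIcc_of_le hz]; simp⟩), sub_add_cancel,
        Real.one_rpow]
      rw [div_neg, ← neg_div, neg_sub]
    rw [e1, e2, Real.volume_Ico, ← ofReal_integral_eq_lintegral_ofReal, e3,
      ← ENNReal.ofReal_mul (by positivity)]
    · congr 1
      field_simp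
    · refine ContinuousOn.integrableOn_Icc fun u hu => ?_
      exact (Real.continuousAt_rpow_const _ _
        (Or.inl (by linarith [hu.1]))).continuousWithinAt
    · filter_upwards [ae_restrict_mem measurableSet_Icc] with u hu
      exact Real.rpow_nonneg (by linarith [hu.1]) _

/-- The volume of the part of a cube cut out by a bound on the sum of the powers. -/
theorem volume_cube_sum_rpow_le {α t : ℝ} (hα : 0 < α) (ht : 0 < t) (K : ℕ) (x : ℝ) :
    volume {u : Fin K → ℝ | (∀ i, u i ∈ Set.Ioo 0 t) ∧ ∑ i, u i ^ (-(α / 2)) ≤ x} =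
      ENNReal.ofReal (t ^ K * paretoCDF α K (x * t ^ (α / 2))) := by
  have hf : Measurable fun u : ℝ => (u / t) ^ (-(α / 2)) := by fun_prop
  have hfs : Measurable fun u : Fin K → ℝ => ∑ i, (u i / t) ^ (-(α / 2)) := by fun_prop
  have hloc := (isLocFiniteNonneg_powMeasure_Ici (-(2 / α))).convPow K
  have htα : 0 < t ^ (α / 2) := Real.rpow_pos_of_pos ht _
  have h1 : {u : Fin K → ℝ | (∀ i, u i ∈ Set.Ioo 0 t) ∧ ∑ i, u i ^ (-(α / 2)) ≤ x} =
      (fun u : Fin K → ℝ => ∑ i, (u i / t) ^ (-(α / 2))) ⁻¹' Set.Iic (x * t ^ (α / 2)) ∩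
        Set.univ.pi fun _ => Set.Ioo 0 t := by
    ext u
    simp only [Set.mem_ofPred_eq, Set.mem_inter_iff, Set.mem_preimage, Set.mem_Iic, Set.mem_pi,
      Set.mem_univ, true_imp_iff]
    rw [and_comm]
    refine and_congr_left fun hu => ?_
    have : ∑ i, (u i / t) ^ (-(α / 2)) = (∑ i, u i ^ (-(α / 2))) * t ^ (α / 2) := by
      rw [Finset.sum_mul]
      refine Finset.sum_congr rfl fun i _ => ?_
      rw [Real.div_rpow (hu i).1.le ht.le, Real.rpow_neg ht.le, div_inv_eq_mul]
    rw [this, mul_le_mul_iff_left₀ htα]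
  rw [h1, ← Measure.restrict_apply (hfs measurableSet_Iic), volume_pi, Measure.restrict_pi_pi,
    ← Measure.map_apply hfs measurableSet_Iic, map_sum_pi _ hf, map_rpow_uniform hα ht,
    convPow_smul, Measure.smul_apply, smul_eq_mul, paretoCDF, ← mul_assoc, ← mul_pow,
    ENNReal.ofReal_mul (p := (t * (2 / α)) ^ K) (by positivity), ENNReal.ofReal_pow (by positivity),
    ofReal_measureReal (hloc.Iic_lt_top _).ne]

/-! ### Nearest distances in a locally finite set -/

section NearestDist

variable {S : Set Plane}

theorem nearestDist_nonneg (S : Set Plane) (i : ℕ) : 0 ≤ nearestDist S i :=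
  Real.sInf_nonneg fun _ hr => hr.1

theorem finite_inter_closedBall (hS : ∀ B : Set Plane, Bornology.IsBounded B → (S ∩ B).Finite)
    (r : ℝ) : (S ∩ Metric.closedBall 0 r).Finite := hS _ Metric.isBounded_closedBall

theorem le_encard_iff (hS : ∀ B : Set Plane, Bornology.IsBounded B → (S ∩ B).Finite)
    (i : ℕ) (r : ℝ) : (i : ℕ∞) ≤ (S ∩ Metric.closedBall 0 r).encard ↔
      i ≤ (S ∩ Metric.closedBall 0 r).ncard := by
  rw [← (finite_inter_closedBall hS r).cast_ncard_eq]
  exact Nat.cast_le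

theorem ncard_closedBall_mono (hS : ∀ B : Set Plane, Bornology.IsBounded B → (S ∩ B).Finite)
    {r r' : ℝ} (h : r ≤ r') :
    (S ∩ Metric.closedBall 0 r).ncard ≤ (S ∩ Metric.closedBall 0 r').ncard :=
  Set.ncard_le_ncard (Set.inter_subset_inter_right _ (Metric.closedBall_subset_closedBall h))
    (finite_inter_closedBall hS r')

/-- The infimum is attained, because local finiteness leaves a gap free of points just beyond it. -/
theorem le_ncard_nearestDist (hS : ∀ B : Set Plane, Bornology.IsBounded B → (S ∩ B).Finite)
    {i : ℕ} (hne : ∃ r, 0 ≤ r ∧ i ≤ (S ∩ Metric.closedBall 0 r).ncard) :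
    i ≤ (S ∩ Metric.closedBall 0 (nearestDist S i)).ncard := by
  set r₀ := nearestDist S i with hr₀
  have hfin := finite_inter_closedBall hS (r₀ + 1)
  -- Only the finitely many points within `r₀ + 1` matter, so one `ε` serves all of them; this is
  -- why `min ε 1` appears below.
  have hev : ∀ᶠ r in nhds r₀, ∀ x ∈ S ∩ Metric.closedBall 0 (r₀ + 1), r₀ < ‖x‖ → r < ‖x‖ := by
    rw [Filter.eventually_all_finite hfin]
    intro x _
    by_cases hx : r₀ < ‖x‖
    · filter_upwards [gt_mem_nhds hx] with r hr _ using hr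
    · exact Filter.Eventually.of_forall fun r h => absurd h hx
  obtain ⟨ε, hε, hball⟩ := Metric.eventually_nhds_iff.1 hev
  have hne' : {r : ℝ | 0 ≤ r ∧ (i : ℕ∞) ≤ (S ∩ Metric.closedBall 0 r).encard}.Nonempty := by
    obtain ⟨r, hr0, hr⟩ := hne
    exact ⟨r, hr0, (le_encard_iff hS i r).2 hr⟩
  obtain ⟨r, ⟨hr0, hri⟩, hrlt⟩ := exists_lt_of_csInf_lt hne'
    (show sInf _ < r₀ + min ε 1 by rw [hr₀, nearestDist]; linarith [lt_min hε one_pos])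
  have hr1 : r < r₀ + ε := hrlt.trans_le (by linarith [min_le_left ε 1])
  have hr2 : r < r₀ + 1 := hrlt.trans_le (by linarith [min_le_right ε 1])
  refine ((le_encard_iff hS i r).1 hri).trans (Set.ncard_le_ncard ?_ (finite_inter_closedBall hS _))
  rintro x ⟨hxS, hxr⟩
  refine ⟨hxS, ?_⟩
  rw [mem_closedBall_zero_iff] at hxr ⊢
  by_contra hlt
  have := hball (y := r) (by rw [Real.dist_eq, abs_of_nonneg (by linarith)]; linarith) x
    ⟨hxS, by rw [mem_closedBall_zero_iff]; linarith⟩ (not_le.1 hlt)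
  linarith

theorem nearestDist_le (hS : ∀ B : Set Plane, Bornology.IsBounded B → (S ∩ B).Finite)
    {i : ℕ} {r : ℝ} (hr : 0 ≤ r) (h : i ≤ (S ∩ Metric.closedBall 0 r).ncard) :
    nearestDist S i ≤ r :=
  csInf_le ⟨0, fun _ h => h.1⟩ ⟨hr, (le_encard_iff hS i r).2 h⟩

/-- With fewer than `i` points in all, `nearestDist` is `sInf ∅ = 0`; the strict bound `0 ≤ r <
nearestDist S i` rules this out. -/
theorem lt_nearestDist_and_le_iff (hS : ∀ B : Set Plane, Bornology.IsBounded B → (S ∩ B).Finite)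
    {i : ℕ} {r r' : ℝ} (hr : 0 ≤ r) (hr' : 0 ≤ r') :
    (r < nearestDist S i ∧ nearestDist S i ≤ r') ↔
      ((S ∩ Metric.closedBall 0 r).ncard < i ∧ i ≤ (S ∩ Metric.closedBall 0 r').ncard) := by
  constructor
  · rintro ⟨h1, h2⟩
    have hne : ∃ r, 0 ≤ r ∧ i ≤ (S ∩ Metric.closedBall 0 r).ncard := by
      by_contra hcon
      have : {r : ℝ | 0 ≤ r ∧ (i : ℕ∞) ≤ (S ∩ Metric.closedBall 0 r).encard} = ∅ := by
        ext s
        simp only [Set.mem_ofPred_eq, Set.mem_empty_iff_false, iff_false]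
        exact fun h => hcon ⟨s, h.1, (le_encard_iff hS i s).1 h.2⟩
      rw [nearestDist, this, Real.sInf_empty] at h1
      linarith
    refine ⟨?_, (le_ncard_nearestDist hS hne).trans (ncard_closedBall_mono hS h2)⟩
    by_contra hcon
    exact absurd (nearestDist_le hS hr (not_lt.1 hcon)) (not_le.2 h1)
  · rintro ⟨h1, h2⟩
    refine ⟨?_, nearestDist_le hS hr' h2⟩
    by_contra hcon
    have := (le_ncard_nearestDist hS ⟨r', hr', h2⟩).trans (ncard_closedBall_mono hS (not_lt.1 hcon))
    omega

/-- Without a strict lower bound the default value `0` must be admitted; it is the second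
alternative, stated with integer radii so that measurability follows from countably many counts. -/
theorem nearestDist_le_iff (hS : ∀ B : Set Plane, Bornology.IsBounded B → (S ∩ B).Finite)
    {i : ℕ} {r : ℝ} (hr : 0 ≤ r) : nearestDist S i ≤ r ↔
      i ≤ (S ∩ Metric.closedBall 0 r).ncard ∨
        ∀ k : ℕ, (S ∩ Metric.closedBall 0 (k : ℝ)).ncard < i := by
  constructor
  · intro h
    by_cases hne : ∃ r, 0 ≤ r ∧ i ≤ (S ∩ Metric.closedBall 0 r).ncard
    · exact Or.inl ((le_ncard_nearestDist hS hne).trans (ncard_closedBall_mono hS h))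
    · refine Or.inr fun k => ?_
      by_contra hcon
      exact hne ⟨k, Nat.cast_nonneg k, not_lt.1 hcon⟩
  · rintro (h | h)
    · exact nearestDist_le hS hr h
    · have : {r : ℝ | 0 ≤ r ∧ (i : ℕ∞) ≤ (S ∩ Metric.closedBall 0 r).encard} = ∅ := by
        ext s
        simp only [Set.mem_ofPred_eq, Set.mem_empty_iff_false, iff_false]
        rintro ⟨_, h2⟩
        obtain ⟨k, hk⟩ := exists_nat_ge s
        have h3 := ((le_encard_iff hS i s).1 h2).trans (ncard_closedBall_mono hS hk)
        have h4 := h k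
        omega
      rw [nearestDist, this, Real.sInf_empty]
      exact hr

end NearestDist

/-! ### Interlacing counts in nested sets -/

section Counting

variable {X : Type*} {S : Set X}

theorem ncard_inter_add_ncard_inter_diff {A B : Set X} (hAB : A ⊆ B) (hB : (S ∩ B).Finite) :
    (S ∩ A).ncard + (S ∩ (B \ A)).ncard = (S ∩ B).ncard := by
  rw [← Set.ncard_union_eq (Set.disjoint_left.2 fun x hx hx' => hx'.2.2 hx.2)
    (hB.subset (Set.inter_subset_inter_right _ hAB))
    (hB.subset (Set.inter_subset_inter_right _ Set.sdiff_subset)),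
    ← Set.inter_union_distrib_left, Set.union_sdiff_cancel hAB]

/-- For nested sets `A 0 ⊆ B 0 ⊆ A 1 ⊆ B 1 ⊆ ⋯`, the sizes of `S ∩ A i` and `S ∩ B i` interlace as
`≤ i` and `> i` iff all but the last of the shells `B i \ A i` contain one point of `S`, the last
one contains a point, and the rest of the last `A i` contains none. -/
theorem interlace_iff {n : ℕ} {A B : Fin (n + 1) → Set X} (hAB : ∀ i, A i ⊆ B i)
    (hBA : ∀ i : Fin n, B i.castSucc ⊆ A i.succ) (hfin : ∀ i, (S ∩ B i).Finite) :
    (∀ i : Fin (n + 1), (S ∩ A i).ncard < (i : ℕ) + 1 ∧ (i : ℕ) + 1 ≤ (S ∩ B i).ncard) ↔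
      (S ∩ (A (Fin.last n) \ ⋃ i : Fin n, (B i.castSucc \ A i.castSucc))).ncard = 0 ∧
        (∀ i : Fin n, (S ∩ (B i.castSucc \ A i.castSucc)).ncard = 1) ∧
        1 ≤ (S ∩ (B (Fin.last n) \ A (Fin.last n))).ncard := by
  have hAmono : Monotone A := Fin.monotone_iff_le_succ.2 fun i => (hAB _).trans (hBA i)
  have hBmono : Monotone B := Fin.monotone_iff_le_succ.2 fun i => (hBA i).trans (hAB _)
  have hfinA (i) : (S ∩ A i).Finite := (hfin i).subset (Set.inter_subset_inter_right _ (hAB i))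
  have hsum (i) := ncard_inter_add_ncard_inter_diff (hAB i) (hfin i)
  have hgap (i : Fin n) := ncard_inter_add_ncard_inter_diff (hBA i) (hfinA i.succ)
  have hZfin : (S ∩ (A (Fin.last n) \ ⋃ i : Fin n, (B i.castSucc \ A i.castSucc))).Finite :=
    (hfinA (Fin.last n)).subset (Set.inter_subset_inter_right _ Set.sdiff_subset)
  rw [Set.ncard_eq_zero hZfin]
  constructor
  · intro h
    -- The count in `A (i + 1)` is at most `i + 1` by hypothesis and at least that of `B i`, hence
    -- at least `i + 1`.
    have hA (i : Fin (n + 1)) : (S ∩ A i).ncard = i := by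
      induction i using Fin.cases with
      | zero => have := (h 0).1; simp at this ⊢; omega
      | succ i =>
        have h1 := (h i.succ).1
        have h2 := (h i.castSucc).2
        have h3 := hgap i
        simp only [Fin.val_castSucc, Fin.val_succ] at h1 h2 ⊢
        omega
    have hB (i : Fin n) : (S ∩ B i.castSucc).ncard = i + 1 := by
      have h1 := hA i.succ
      have h2 := (h i.castSucc).2
      have h3 := hgap i
      simp only [Fin.val_castSucc, Fin.val_succ] at h1 h2
      omega
    refine ⟨?_, fun i => ?_, ?_⟩
    · rw [Set.eq_empty_iff_forall_notMem]
      rintro x ⟨hxS, hxA, hxE⟩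
      have hx (i : Fin (n + 1)) : x ∉ A i := by
        induction i using Fin.induction with
        | zero =>
          intro hx
          have h0 := hA 0
          rw [Fin.val_zero, Set.ncard_eq_zero (hfinA 0)] at h0
          exact (Set.eq_empty_iff_forall_notMem.1 h0) x ⟨hxS, hx⟩
        | succ i ih =>
          intro hx
          have hxB : x ∉ B i.castSucc := fun hxB => hxE (Set.mem_iUnion.2 ⟨i, hxB, ih⟩)
          have h1 : (S ∩ (A i.succ \ B i.castSucc)).ncard = 0 := by
            have h2 := hgap i
            rw [hB i, hA i.succ, Fin.val_succ] at h2
            omega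
          rw [Set.ncard_eq_zero ((hfinA i.succ).subset
            (Set.inter_subset_inter_right _ Set.sdiff_subset))] at h1
          exact (Set.eq_empty_iff_forall_notMem.1 h1) x ⟨hxS, hx, hxB⟩
      exact hx _ hxA
    · have h1 := hsum i.castSucc
      rw [hA, hB, Fin.val_castSucc] at h1
      omega
    · have h1 := hsum (Fin.last n)
      have h2 := (h (Fin.last n)).2
      rw [hA, Fin.val_last] at h1
      rw [Fin.val_last] at h2
      omega
  · rintro ⟨hZ, hE, hlast⟩
    have hnot : ∀ x ∈ S, x ∈ A (Fin.last n) → ∃ i : Fin n, x ∈ B i.castSucc ∧ x ∉ A i.castSucc := by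
      intro x hxS hxA
      by_contra hcon
      refine (Set.eq_empty_iff_forall_notMem.1 hZ) x ⟨hxS, hxA, fun hx => hcon ?_⟩
      obtain ⟨i, hi⟩ := Set.mem_iUnion.1 hx
      exact ⟨i, hi⟩
    have hA (i : Fin (n + 1)) : (S ∩ A i).ncard = i := by
      induction i using Fin.induction with
      | zero =>
        rw [Fin.val_zero, Set.ncard_eq_zero (hfinA 0), Set.eq_empty_iff_forall_notMem]
        rintro x ⟨hxS, hx⟩
        obtain ⟨i, -, hi⟩ := hnot x hxS (hAmono (Fin.le_last 0) hx)
        exact hi (hAmono (Fin.zero_le _) hx)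
      | succ i ih =>
        have h1 := hsum i.castSucc
        rw [ih, hE i, Fin.val_castSucc] at h1
        have h2 := hgap i
        have h3 : (S ∩ (A i.succ \ B i.castSucc)).ncard = 0 := by
          rw [Set.ncard_eq_zero ((hfinA i.succ).subset
            (Set.inter_subset_inter_right _ Set.sdiff_subset)), Set.eq_empty_iff_forall_notMem]
          rintro x ⟨hxS, hx, hxB⟩
          obtain ⟨k, hk, hk'⟩ := hnot x hxS (hAmono (Fin.le_last _) hx)
          rcases le_or_gt k i with hki | hki
          · exact hxB (hBmono (Fin.castSucc_le_castSucc_iff.2 hki) hk)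
          · exact hk' (hAmono (Fin.succ_le_castSucc_iff.2 hki) hx)
        rw [Fin.val_succ]
        omega
    intro i
    have h1 := hsum i
    rw [hA i] at h1 ⊢
    refine ⟨Nat.lt_succ_self _, ?_⟩
    have h2 : 1 ≤ (S ∩ (B i \ A i)).ncard := by
      induction i using Fin.lastCases with
      | last => exact hlast
      | cast i => rw [hE i]
    omega

end Counting

/-! ### Measurability and the probabilities of shell events -/

theorem measurable_nearestDist {Ω : Type*} [MeasurableSpace Ω] {P : Measure Ω} {lam : ℝ}
    {Φ : Ω → Set Plane} (hΦ : IsHPPP P lam Φ) (i : ℕ) :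
    Measurable fun ω => nearestDist (Φ ω) i := by
  have hm (r : ℝ) : Measurable fun ω => (Φ ω ∩ Metric.closedBall 0 r).ncard :=
    hΦ.measurable_count _ Metric.isClosed_closedBall.measurableSet Metric.isBounded_closedBall
  refine measurable_of_Iic fun r => ?_
  rcases lt_or_ge r 0 with hr | hr
  · convert MeasurableSet.empty
    ext ω
    simp only [Set.mem_preimage, Set.mem_Iic, Set.mem_empty_iff_false, iff_false, not_le]
    exact hr.trans_le (nearestDist_nonneg _ _)
  · have : (fun ω => nearestDist (Φ ω) i) ⁻¹' Set.Iic r =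
        {ω | i ≤ (Φ ω ∩ Metric.closedBall 0 r).ncard} ∪
          ⋂ k : ℕ, {ω | (Φ ω ∩ Metric.closedBall 0 (k : ℝ)).ncard < i} := by
      ext ω
      simp only [Set.mem_preimage, Set.mem_Iic, nearestDist_le_iff (hΦ.finite_inter ω) hr,
        Set.mem_union, Set.mem_ofPred_eq, Set.mem_iInter]
    rw [this]
    refine (measurableSet_le measurable_const (hm r)).union (MeasurableSet.iInter fun k => ?_)
    exact measurableSet_lt (hm k) measurable_const

theorem measurable_pathLossSum {Ω : Type*} [MeasurableSpace Ω] {P : Measure Ω} {lam : ℝ}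
    {Φ : Ω → Set Plane} (hΦ : IsHPPP P lam Φ) (α : ℝ) (K : ℕ) :
    Measurable fun ω => pathLossSum α K (Φ ω) :=
  Finset.measurable_sum _ fun i _ => (measurable_nearestDist hΦ i).pow_const _

/-- The disk around the origin that contains `u` points on average. -/
def disk (lam u : ℝ) : Set Plane := Metric.closedBall 0 (√(u / (lam * Real.pi)))

theorem disk_mono {lam : ℝ} (hlam : 0 < lam) : Monotone (disk lam) := fun _ _ h =>
  Metric.closedBall_subset_closedBall (Real.sqrt_le_sqrt (by gcongr))

theorem measurableSet_disk (lam u : ℝ) : MeasurableSet (disk lam u) :=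
  Metric.isClosed_closedBall.measurableSet

theorem isBounded_disk (lam u : ℝ) : Bornology.IsBounded (disk lam u) := Metric.isBounded_closedBall

theorem volume_disk {lam u : ℝ} (hlam : 0 < lam) (hu : 0 ≤ u) :
    volume.real (disk lam u) = u / lam := by
  have hpi := Real.pi_pos
  rw [disk, measureReal_def, EuclideanSpace.volume_closedBall_fin_two, ENNReal.toReal_mul,
    ENNReal.toReal_pow, ENNReal.toReal_ofReal (Real.sqrt_nonneg _), Real.sq_sqrt (by positivity)]
  rw [ENNReal.toReal_ofReal hpi.le]
  field_simp

theorem volume_disk_ne_top (lam u : ℝ) : volume (disk lam u) ≠ ∞ :=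
  (isBounded_disk lam u).measure_lt_top.ne

/-- The mean number of points in the disk through the `i`-th nearest point of `S`. -/
def scaledDist (lam : ℝ) (S : Set Plane) (i : ℕ) : ℝ := lam * Real.pi * nearestDist S i ^ 2

theorem lt_scaledDist_and_le_iff {lam : ℝ} (hlam : 0 < lam) {S : Set Plane}
    (hS : ∀ B : Set Plane, Bornology.IsBounded B → (S ∩ B).Finite) {i : ℕ} {a b : ℝ}
    (ha : 0 ≤ a) (hb : 0 ≤ b) : scaledDist lam S i ∈ Set.Ioc a b ↔
      ((S ∩ disk lam a).ncard < i ∧ i ≤ (S ∩ disk lam b).ncard) := by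
  have hc : 0 < lam * Real.pi := mul_pos hlam Real.pi_pos
  rw [disk, disk, ← lt_nearestDist_and_le_iff hS (Real.sqrt_nonneg _) (Real.sqrt_nonneg _),
    Set.mem_Ioc, scaledDist, Real.sqrt_lt (by positivity) (nearestDist_nonneg _ _),
    Real.le_sqrt (nearestDist_nonneg _ _) (by positivity), div_lt_iff₀' hc, le_div_iff₀' hc]

theorem measure_count_eq {Ω : Type*} [MeasurableSpace Ω] {P : Measure Ω} {lam : ℝ}
    {Φ : Ω → Set Plane} (hΦ : IsHPPP P lam Φ) (hlam : 0 < lam) {B : Set Plane}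
    (hB : MeasurableSet B) (hb : Bornology.IsBounded B) (k : ℕ) :
    P ((fun ω => (Φ ω ∩ B).ncard) ⁻¹' {k}) = ENNReal.ofReal
      (Real.exp (-(lam * volume.real B)) * (lam * volume.real B) ^ k / k !) := by
  rw [← Measure.map_apply (hΦ.measurable_count B hB hb) (measurableSet_singleton k),
    hΦ.map_count B hB hb, poissonMeasure_singleton,
    Real.coe_toNNReal _ (by positivity)]

theorem measure_one_le_count {Ω : Type*} [MeasurableSpace Ω] {P : Measure Ω}
    [IsProbabilityMeasure P] {lam : ℝ}
    {Φ : Ω → Set Plane} (hΦ : IsHPPP P lam Φ) (hlam : 0 < lam) {B : Set Plane}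
    (hB : MeasurableSet B) (hb : Bornology.IsBounded B) :
    P ((fun ω => (Φ ω ∩ B).ncard) ⁻¹' (Set.Ici 1)) = ENNReal.ofReal
      (1 - Real.exp (-(lam * volume.real B))) := by
  have h : (fun ω => (Φ ω ∩ B).ncard) ⁻¹' (Set.Ici 1) =
      ((fun ω => (Φ ω ∩ B).ncard) ⁻¹' {0})ᶜ := by
    ext ω; simp [Nat.one_le_iff_ne_zero]
  rw [h, prob_compl_eq_one_sub (hΦ.measurable_count B hB hb (measurableSet_singleton 0)),
    measure_count_eq hΦ hlam hB hb, ← ENNReal.ofReal_one, ← ENNReal.ofReal_sub _ (by positivity)]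
  simp

/-- The probability that the scaled distances lie in given consecutive intervals. -/
theorem measure_scaledDist_mem {Ω : Type*} [MeasurableSpace Ω] {P : Measure Ω}
    [IsProbabilityMeasure P] {lam : ℝ} {Φ : Ω → Set Plane} (hΦ : IsHPPP P lam Φ) (hlam : 0 < lam)
    {n : ℕ} {a b : Fin (n + 1) → ℝ} (ha : ∀ i, 0 ≤ a i) (hab : ∀ i, a i ≤ b i)
    (hba : ∀ i : Fin n, b i.castSucc ≤ a i.succ) :
    P {ω | ∀ i : Fin (n + 1), scaledDist lam (Φ ω) (i + 1) ∈ Set.Ioc (a i) (b i)} =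
      ENNReal.ofReal ((∏ i : Fin n, (b i.castSucc - a i.castSucc)) *
        (Real.exp (-a (Fin.last n)) - Real.exp (-b (Fin.last n)))) := by
  have hb (i) : 0 ≤ b i := (ha i).trans (hab i)
  have hamono : Monotone a := Fin.monotone_iff_le_succ.2 fun i => (hab _).trans (hba i)
  -- The `n + 1` shells `E i` and the remainder `Z` of the disk inside the last shell are disjoint,
  -- so their counts are independent.
  let E : Fin (n + 1) → Set Plane := fun i => disk lam (b i) \ disk lam (a i)
  let Z : Set Plane := disk lam (a (Fin.last n)) \ ⋃ i : Fin n, E i.castSucc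
  have hEm (i) : MeasurableSet (E i) := (measurableSet_disk _ _).diff (measurableSet_disk _ _)
  have hEb (i) : Bornology.IsBounded (E i) := (isBounded_disk lam (b i)).subset Set.sdiff_subset
  have hZm : MeasurableSet Z := (measurableSet_disk _ _).diff (.iUnion fun i => hEm _)
  have hZb : Bornology.IsBounded Z := (isBounded_disk lam _).subset Set.sdiff_subset
  have hEvol (i) : lam * volume.real (E i) = b i - a i := by
    rw [measureReal_sdiff (disk_mono hlam (hab i)) (measurableSet_disk _ _)
      (volume_disk_ne_top _ _), volume_disk hlam (hb i), volume_disk hlam (ha i)]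
    field_simp
  have hElt {i j : Fin (n + 1)} (hij : i < j) : Disjoint (E i) (E j) := by
    refine Set.disjoint_left.2 fun x hx hx' => hx'.2 ?_
    refine disk_mono hlam ?_ hx.1
    induction i using Fin.lastCases with
    | last => exact absurd hij (not_lt.2 (Fin.le_last j))
    | cast i => exact (hba i).trans (hamono (Fin.castSucc_lt_iff_succ_le.1 hij))
  have hEdisj : Pairwise fun i j => Disjoint (E i) (E j) := fun i j hij => by
    rcases lt_or_gt_of_ne hij with h | h
    · exact hElt h
    · exact (hElt h).symm
  have hEZ (i) : Disjoint Z (E i) := by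
    refine Set.disjoint_left.2 fun x hx hx' => ?_
    induction i using Fin.lastCases with
    | last => exact hx'.2 hx.1
    | cast i => exact hx.2 (Set.mem_iUnion.2 ⟨i, hx'⟩)
  have hsub : (⋃ i : Fin n, E i.castSucc) ⊆ disk lam (a (Fin.last n)) := by
    refine Set.iUnion_subset fun i => Set.sdiff_subset.trans (disk_mono hlam ?_)
    exact (hba i).trans (hamono (Fin.le_last _))
  have hZvol : lam * volume.real Z =
      a (Fin.last n) - ∑ i : Fin n, (b i.castSucc - a i.castSucc) := by
    have h1 : volume.real (⋃ i : Fin n, E i.castSucc) = ∑ i : Fin n, volume.real (E i.castSucc) :=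
      measureReal_iUnion_fintype
        (fun i j hij => hEdisj fun h => hij (Fin.castSucc_injective n h)) (fun i => hEm _)
        (fun i => (hEb _).measure_lt_top.ne)
    rw [measureReal_sdiff hsub (.iUnion fun i => hEm _)
      (volume_disk_ne_top _ _), volume_disk hlam (ha _), h1, mul_sub,
      Finset.mul_sum]
    simp_rw [hEvol]
    field_simp
  let B : Fin (n + 2) → Set Plane := Fin.cons Z E
  -- None in `Z`, exactly one in each shell but the last, at least one in the last: further points
  -- there do not affect the first `n + 1`.
  let T : Fin (n + 2) → Set ℕ :=
    Fin.cons {0} (Fin.snoc (α := fun _ => Set ℕ) (fun _ : Fin n => {1}) (Set.Ici 1))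
  have hind := hΦ.indep_count (n + 2) B
    (fun k => by induction k using Fin.cases with
      | zero => exact hZm
      | succ i => exact hEm i)
    (fun k => by induction k using Fin.cases with
      | zero => exact hZb
      | succ i => exact hEb i)
    (fun k l hkl => by
      induction k using Fin.cases with
      | zero => induction l using Fin.cases with
        | zero => exact absurd rfl hkl
        | succ j => exact hEZ j
      | succ i => induction l using Fin.cases with
        | zero => exact (hEZ i).symm
        | succ j => exact hEdisj fun h => hkl (congrArg Fin.succ h))
  have hprod := hind.measure_inter_preimage_eq_mul Finset.univ (sets := T)
    (fun i _ => MeasurableSet.of_discrete)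
  have hset : {ω | ∀ i : Fin (n + 1), scaledDist lam (Φ ω) (i + 1) ∈ Set.Ioc (a i) (b i)} =
      ⋂ i ∈ (Finset.univ : Finset (Fin (n + 2))), (fun ω => (Φ ω ∩ B i).ncard) ⁻¹' T i := by
    ext ω
    simp only [Set.mem_ofPred_eq, Finset.mem_univ, Set.iInter_true, Set.mem_iInter,
      Set.mem_preimage]
    rw [forall_congr' fun i : Fin (n + 1) =>
      lt_scaledDist_and_le_iff hlam (hΦ.finite_inter ω) (ha i) (hb i),
      interlace_iff (fun i => disk_mono hlam (hab i)) (fun i => disk_mono hlam (hba i))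
        (fun i => hΦ.finite_inter ω _ (isBounded_disk _ _)), Fin.forall_fin_succ,
      Fin.forall_fin_succ']
    simp [B, T, E, Z]
  rw [hset, hprod, Fin.prod_univ_succ, Fin.prod_univ_castSucc]
  simp only [B, T, Fin.cons_zero, Fin.cons_succ, Fin.snoc_castSucc, Fin.snoc_last]
  rw [measure_count_eq hΦ hlam hZm hZb, measure_one_le_count hΦ hlam (hEm _) (hEb _)]
  simp only [measure_count_eq hΦ hlam (hEm _) (hEb _), hEvol, hZvol]
  have hba' (i : Fin (n + 1)) : 0 ≤ b i - a i := sub_nonneg.2 (hab i)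
  rw [← ENNReal.ofReal_prod_of_nonneg, ← ENNReal.ofReal_mul, ← ENNReal.ofReal_mul]
  · congr 1
    simp only [pow_zero, pow_one, Nat.factorial_zero, Nat.factorial_one, Nat.cast_one, div_one,
      mul_one, Finset.prod_mul_distrib, ← Real.exp_sum, Finset.sum_neg_distrib]
    -- The void probability of `Z` and the exponentials of the first `n` shells multiply to `exp (-a
    -- (Fin.last n))`.
    have e1 : Real.exp (-b (Fin.last n)) =
        Real.exp (-a (Fin.last n)) * Real.exp (-(b (Fin.last n) - a (Fin.last n))) := by
      rw [← Real.exp_add]; ring_nf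
    have e2 : Real.exp (-a (Fin.last n)) =
        Real.exp (-(a (Fin.last n) - ∑ i : Fin n, (b i.castSucc - a i.castSucc))) *
          Real.exp (-∑ i : Fin n, (b i.castSucc - a i.castSucc)) := by
      rw [← Real.exp_add]; ring_nf
    rw [e1, e2]
    ring
  · positivity
  · exact Finset.prod_nonneg fun i _ => by
      have := hba' i.castSucc
      positivity
  · intro i _
    have := hba' i.castSucc
    positivity

/-! ### The joint law of the arrivals on the cone -/

/-- The density `e ^ (-t)` on the line. -/
def expWeight : Measure ℝ := volume.withDensity fun t => ENNReal.ofReal (Real.exp (-t))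

instance : SFinite expWeight := by rw [expWeight]; infer_instance

theorem integrableOn_exp_neg_Ioc (c d : ℝ) : IntegrableOn (fun t => Real.exp (-t)) (Set.Ioc c d) :=
  (Continuous.integrableOn_Icc (by fun_prop)).mono_set Set.Ioc_subset_Icc_self

theorem expWeight_Ioc {c d : ℝ} (h : c ≤ d) :
    expWeight (Set.Ioc c d) = ENNReal.ofReal (Real.exp (-c) - Real.exp (-d)) := by
  rw [expWeight, withDensity_apply _ measurableSet_Ioc, ← ofReal_integral_eq_lintegral_ofReal
    (integrableOn_exp_neg_Ioc c d) (Filter.Eventually.of_forall fun t => (Real.exp_pos _).le),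
    ← intervalIntegral.integral_of_le h, intervalIntegral.integral_comp_neg (fun t => Real.exp t),
    integral_exp]

/-- The measure which, restricted to increasing positive sequences, is the joint law of the first
`n + 1` points of a Poisson process of unit density on the half-line. -/
def arrivalMeasure (n : ℕ) : Measure ((Fin n → ℝ) × ℝ) := volume.prod expWeight

/-- A box in `ℝⁿ × ℝ`. -/
def box {n : ℕ} (a b : Fin n → ℝ) (c d : ℝ) : Set ((Fin n → ℝ) × ℝ) :=
  (Set.univ.pi fun i => Set.Ioc (a i) (b i)) ×ˢ Set.Ioc c d

theorem measurableSet_box {n : ℕ} (a b : Fin n → ℝ) (c d : ℝ) : MeasurableSet (box a b c d) :=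
  (MeasurableSet.univ_pi fun _ => measurableSet_Ioc).prod measurableSet_Ioc

/-- Cutting a box by a quadrant only lowers its upper corner, so the ordering conditions persist.
Knowing the masses of ordered boxes therefore identifies whole measures restricted to such a box. -/
theorem box_inter {n : ℕ} (a b e : Fin n → ℝ) (c d f : ℝ) :
    box a b c d ∩ ((Set.univ.pi fun i => Set.Iic (e i)) ×ˢ Set.Iic f) =
      box a (fun i => min (b i) (e i)) c (min d f) := by
  ext p
  simp only [box, Set.mem_inter_iff, Set.mem_prod, Set.mem_pi, Set.mem_univ, true_imp_iff,
    Set.mem_Ioc, Set.mem_Iic, le_inf_iff]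
  constructor
  · rintro ⟨⟨h1, h2⟩, h3, h4⟩
    exact ⟨fun i => ⟨(h1 i).1, (h1 i).2, h3 i⟩, h2.1, h2.2, h4⟩
  · rintro ⟨h1, h2⟩
    exact ⟨⟨fun i => ⟨(h1 i).1, (h1 i).2.1⟩, h2.1, h2.2.1⟩, fun i => (h1 i).2.2, h2.2.2⟩

theorem arrivalMeasure_box {n : ℕ} {a b : Fin n → ℝ} {c d : ℝ} (hab : ∀ i, a i ≤ b i)
    (hcd : c ≤ d) : arrivalMeasure n (box a b c d) =
      ENNReal.ofReal ((∏ i, (b i - a i)) * (Real.exp (-c) - Real.exp (-d))) := by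
  rw [arrivalMeasure, box, Measure.prod_prod, Real.volume_pi_Ioc, expWeight_Ioc hcd,
    ENNReal.ofReal_mul (Finset.prod_nonneg fun i _ => sub_nonneg.2 (hab i)),
    ENNReal.ofReal_prod_of_nonneg fun i _ => sub_nonneg.2 (hab i)]

theorem ext_of_pi_Iic_prod_Iic {n : ℕ} {μ ν : Measure ((Fin n → ℝ) × ℝ)} [IsFiniteMeasure μ]
    (h : ∀ (e : Fin n → ℝ) (f : ℝ), μ ((Set.univ.pi fun i => Set.Iic (e i)) ×ˢ Set.Iic f) =
      ν ((Set.univ.pi fun i => Set.Iic (e i)) ×ˢ Set.Iic f))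
    (huniv : μ Set.univ = ν Set.univ) : μ = ν := by
  have hspan : IsCountablySpanning (Set.range (Set.Iic : ℝ → Set ℝ)) :=
    ⟨fun k : ℕ => Set.Iic (k : ℝ), fun k => ⟨_, rfl⟩,
      Set.eq_univ_of_forall fun x => Set.mem_iUnion.2 (exists_nat_ge x)⟩
  have hpi : IsPiSystem (Set.range (Set.Iic : ℝ → Set ℝ)) := by
    rintro _ ⟨x, rfl⟩ _ ⟨y, rfl⟩ _
    exact ⟨min x y, Set.Iic_inter_Iic.symm⟩
  have hb : (inferInstance : MeasurableSpace ℝ) =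
      MeasurableSpace.generateFrom (Set.range (Set.Iic : ℝ → Set ℝ)) := by
    rw [← borel_eq_generateFrom_Iic]; exact BorelSpace.measurable_eq
  have hgen : (inferInstance : MeasurableSpace ((Fin n → ℝ) × ℝ)) = MeasurableSpace.generateFrom
      (Set.image2 (· ×ˢ ·) (Set.univ.pi '' Set.univ.pi fun _ : Fin n => Set.range Set.Iic)
        (Set.range (Set.Iic : ℝ → Set ℝ))) := by
    rw [← generateFrom_prod_eq (IsCountablySpanning.pi fun _ => hspan) hspan,
      ← generateFrom_pi_eq fun _ => hspan, ← hb]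
  refine ext_of_generate_finite _ hgen ((IsPiSystem.pi fun _ => hpi).prod hpi) ?_ huniv
  rintro _ ⟨_, ⟨g, hg, rfl⟩, _, ⟨f, rfl⟩, rfl⟩
  choose e he using fun i => hg i (Set.mem_univ i)
  have : g = fun i => Set.Iic (e i) := funext fun i => (he i).symm
  rw [this]
  exact h e f

/-- The increasing sequences of positive numbers. -/
def arrivalCone (n : ℕ) : Set ((Fin n → ℝ) × ℝ) :=
  {p | (∀ i, 0 < p.1 i) ∧ StrictMono p.1 ∧ (∀ i, p.1 i < p.2) ∧ 0 < p.2}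

/-- Rationals chosen between consecutive coordinates put each point of the cone in an ordered box;
only countably many boxes arise. -/
theorem arrivalCone_subset (n : ℕ) : arrivalCone n ⊆
    ⋃ r : {r : (Fin (n + 1) → ℚ) × ℚ // Monotone r.1 ∧ 0 ≤ r.1 0},
      box (fun i => (r.1.1 i.castSucc : ℝ)) (fun i => (r.1.1 i.succ : ℝ)) (r.1.1 (Fin.last n))
        r.1.2 := by
  rintro ⟨u, t⟩ ⟨hu0, hmono, hut, ht⟩
  let w : Fin (n + 1) → ℝ := Fin.snoc u t
  -- `q` lies strictly between the previous coordinate (or `0`) and `w i`.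
  have hw : ∀ i : Fin (n + 1), ∃ q : ℚ, (q : ℝ) < w i ∧ 0 ≤ q ∧
      ∀ j : Fin n, j.succ = i → w j.castSucc < q := by
    intro i
    induction i using Fin.cases with
    | zero =>
      have h0 : 0 < w 0 := by
        rcases Nat.eq_zero_or_pos n with rfl | hn
        · exact ht
        · have : w 0 = u ⟨0, hn⟩ := Fin.snoc_castSucc (α := fun _ => ℝ) t u ⟨0, hn⟩
          rw [this]
          exact hu0 _
      obtain ⟨q, hq1, hq2⟩ := exists_rat_btwn h0
      exact ⟨q, hq2, by exact_mod_cast hq1.le, fun j hj => absurd hj (Fin.succ_ne_zero j)⟩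
    | succ i =>
      have hi : w i.castSucc < w i.succ := by
        have : ∀ k : Fin (n + 1), i.castSucc < k → w i.castSucc < w k := by
          intro k
          induction k using Fin.lastCases with
          | last => intro _; simpa [w] using hut i
          | cast k => intro hk; simpa [w] using hmono (Fin.castSucc_lt_castSucc_iff.1 hk)
        exact this _ (Fin.castSucc_lt_succ)
      have hi0 : 0 < w i.castSucc := by simpa [w] using hu0 i
      obtain ⟨q, hq1, hq2⟩ := exists_rat_btwn hi
      refine ⟨q, hq2, by exact_mod_cast (hi0.trans hq1).le, fun j hj => ?_⟩
      rwa [Fin.succ_injective _ hj]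
  choose q hq1 hq2 hq3 using hw
  obtain ⟨d, hd⟩ := exists_rat_gt t
  have hqmono : Monotone q := Fin.monotone_iff_le_succ.2 fun i => by
    have : (q i.castSucc : ℝ) < q i.succ := (hq1 _).trans (hq3 _ i rfl)
    exact_mod_cast this.le
  refine Set.mem_iUnion.2 ⟨⟨(q, d), hqmono, hq2 0⟩, ?_⟩
  refine ⟨fun i _ => ⟨?_, ?_⟩, ?_, hd.le⟩
  · simpa [w] using hq1 i.castSucc
  · simpa [w] using (hq3 _ i rfl).le
  · simpa [w] using hq1 (Fin.last n)

section Law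

variable {Ω : Type*} [MeasurableSpace Ω] {P : Measure Ω} {lam : ℝ}
  {Φ : Ω → Set Plane}

/-- The scaled distances of the first `n + 1` points. -/
def arrivals (lam : ℝ) (n : ℕ) (S : Set Plane) : (Fin n → ℝ) × ℝ :=
  (fun i => scaledDist lam S (i + 1), scaledDist lam S (n + 1))

theorem measurable_arrivals (hΦ : IsHPPP P lam Φ) (n : ℕ) :
    Measurable fun ω => arrivals lam n (Φ ω) := by
  have h (i : ℕ) : Measurable fun ω => scaledDist lam (Φ ω) i :=
    ((measurable_nearestDist hΦ i).pow_const 2).const_mul _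
  exact (measurable_pi_lambda _ fun i => h _).prodMk (h _)

variable [IsProbabilityMeasure P]

theorem map_arrivals_box (hΦ : IsHPPP P lam Φ) (hlam : 0 < lam) {n : ℕ} {a b : Fin n → ℝ}
    {c d : ℝ} (ha : ∀ i, 0 ≤ a i) (hc : 0 ≤ c) (hba : ∀ i j, i < j → b i ≤ a j)
    (hbc : ∀ i, b i ≤ c) :
    P.map (fun ω => arrivals lam n (Φ ω)) (box a b c d) = arrivalMeasure n (box a b c d) := by
  -- A box cut by a quadrant may be empty; otherwise a point of it supplies `a ≤ b` and `c ≤ d`.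
  rcases Set.eq_empty_or_nonempty (box a b c d) with he | ⟨⟨u, t⟩, hu, ht⟩
  · simp [he]
  have hab (i) : a i ≤ b i := ((hu i trivial).1.trans_le (hu i trivial).2).le
  have hcd : c ≤ d := (ht.1.trans_le ht.2).le
  have h := measure_scaledDist_mem hΦ hlam (n := n) (a := Fin.snoc (α := fun _ => ℝ) a c)
    (b := Fin.snoc (α := fun _ => ℝ) b d)
    (fun i => by induction i using Fin.lastCases <;> simp [ha, hc])
    (fun i => by induction i using Fin.lastCases <;> simp [hab, hcd])
    (fun i => by
      have : ∀ k : Fin (n + 1), i.castSucc < k → b i ≤ Fin.snoc (α := fun _ => ℝ) a c k := by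
        intro k
        induction k using Fin.lastCases with
        | last => intro _; simpa using hbc i
        | cast k => intro hk; simpa using hba i k (Fin.castSucc_lt_castSucc_iff.1 hk)
      simpa using this _ (Fin.castSucc_lt_succ))
  simp only [Fin.snoc_castSucc, Fin.snoc_last] at h
  rw [arrivalMeasure_box hab hcd, ← h, Measure.map_apply (measurable_arrivals hΦ n)
    (measurableSet_box _ _ _ _)]
  congr 1
  ext ω
  simp only [Set.mem_preimage, Set.mem_ofPred_eq, Fin.forall_fin_succ', box, arrivals,
    Set.mem_prod, Set.mem_pi, Set.mem_univ, true_imp_iff, Fin.snoc_castSucc, Fin.snoc_last,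
    Fin.val_castSucc, Fin.val_last]

theorem restrict_map_arrivals_box (hΦ : IsHPPP P lam Φ) (hlam : 0 < lam) {n : ℕ}
    {a b : Fin n → ℝ} {c d : ℝ} (ha : ∀ i, 0 ≤ a i) (hc : 0 ≤ c)
    (hba : ∀ i j, i < j → b i ≤ a j) (hbc : ∀ i, b i ≤ c) :
    (P.map (fun ω => arrivals lam n (Φ ω))).restrict (box a b c d) =
      (arrivalMeasure n).restrict (box a b c d) := by
  have := Measure.isProbabilityMeasure_map (μ := P) (measurable_arrivals hΦ n).aemeasurable
  refine ext_of_pi_Iic_prod_Iic (fun e f => ?_) ?_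
  · have hm : MeasurableSet ((Set.univ.pi fun i => Set.Iic (e i)) ×ˢ Set.Iic f) :=
      (MeasurableSet.univ_pi fun _ => measurableSet_Iic).prod measurableSet_Iic
    rw [Measure.restrict_apply hm, Measure.restrict_apply hm, Set.inter_comm, box_inter]
    exact map_arrivals_box hΦ hlam ha hc (fun i j hij => (min_le_left _ _).trans (hba i j hij))
      fun i => (min_le_left _ _).trans (hbc i)
  · rw [Measure.restrict_apply_univ, Measure.restrict_apply_univ]
    exact map_arrivals_box hΦ hlam ha hc hba hbc

theorem restrict_map_arrivals (hΦ : IsHPPP P lam Φ) (hlam : 0 < lam) (n : ℕ) :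
    (P.map (fun ω => arrivals lam n (Φ ω))).restrict (arrivalCone n) =
      (arrivalMeasure n).restrict (arrivalCone n) := by
  refine Measure.restrict_congr_mono (arrivalCone_subset n) ?_
  rw [Measure.restrict_iUnion_congr]
  rintro ⟨⟨q, d⟩, hq, hq0⟩
  have hq0' (i) : 0 ≤ q i := hq0.trans (hq (Fin.zero_le i))
  refine restrict_map_arrivals_box hΦ hlam (fun i => by exact_mod_cast hq0' _)
    (by exact_mod_cast hq0' _) (fun i j hij => ?_) fun i => ?_
  · exact_mod_cast hq (Fin.succ_le_castSucc_iff.2 hij)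
  · exact_mod_cast hq (Fin.le_last _)

end Law

/-! ### Symmetrisation and the law of the path-loss sum -/

section Sorting

variable {n : ℕ}

/-- Ties lie in finitely many hyperplanes `u i = u j`. -/
theorem volume_not_injective : volume {u : Fin n → ℝ | ¬ Function.Injective u} = 0 := by
  let L (i j : Fin n) : (Fin n → ℝ) →ₗ[ℝ] ℝ :=
    (LinearMap.proj i : (Fin n → ℝ) →ₗ[ℝ] ℝ) - (LinearMap.proj j : (Fin n → ℝ) →ₗ[ℝ] ℝ)
  have h : {u : Fin n → ℝ | ¬ Function.Injective u} ⊆ ⋃ p : {p : Fin n × Fin n // p.1 ≠ p.2},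
      (LinearMap.ker (L p.1.1 p.1.2) : Set (Fin n → ℝ)) := by
    intro u hu
    simp only [Set.mem_ofPred_eq, Function.Injective, not_forall] at hu
    obtain ⟨i, j, hij, hne⟩ := hu
    exact Set.mem_iUnion.2 ⟨⟨(i, j), hne⟩, by simp [L, hij]⟩
  refine measure_mono_null h (measure_iUnion_null fun p => Measure.addHaar_submodule _ _ fun ht => ?_)
  have : (Pi.single p.1.1 1 : Fin n → ℝ) ∈ LinearMap.ker (L p.1.1 p.1.2) := by
    rw [ht]; trivial
  have hne : p.1.2 ≠ p.1.1 := fun h => p.2 h.symm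
  simp [L, Pi.single_eq_of_ne hne] at this

theorem measurableSet_strictMono_comp (σ : Equiv.Perm (Fin n)) :
    MeasurableSet {u : Fin n → ℝ | StrictMono (u ∘ σ)} := by
  have : {u : Fin n → ℝ | StrictMono (u ∘ σ)} =
      ⋂ i, ⋂ j, ⋂ _ : i < j, {u : Fin n → ℝ | u (σ i) < u (σ j)} := by
    ext u; simp [StrictMono]
  rw [this]
  exact .iInter fun i => .iInter fun j => .iInter fun _ =>
    measurableSet_lt (measurable_pi_apply _) (measurable_pi_apply _)

/-- A symmetric set is made up of `n!` copies of its increasing part. -/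
theorem volume_eq_factorial_mul {A : Set (Fin n → ℝ)} (hA : MeasurableSet A)
    (hsymm : ∀ (σ : Equiv.Perm (Fin n)) (u : Fin n → ℝ), u ∘ σ ∈ A ↔ u ∈ A) :
    volume A = n ! * volume (A ∩ {u | StrictMono u}) := by
  let C : Equiv.Perm (Fin n) → Set (Fin n → ℝ) := fun σ => A ∩ {u | StrictMono (u ∘ σ)}
  have hCm (σ) : MeasurableSet (C σ) := hA.inter (measurableSet_strictMono_comp σ)
  have hae : A =ᵐ[volume] ⋃ σ, C σ := by
    have hinj : ∀ᵐ u : Fin n → ℝ, Function.Injective u := volume_not_injective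
    filter_upwards [hinj] with u hu
    refine propext ⟨fun h => Set.mem_iUnion.2 ⟨Tuple.sort u, h, ?_⟩, fun h => ?_⟩
    · exact (Tuple.monotone_sort u).strictMono_of_injective (hu.comp (Tuple.sort u).injective)
    · obtain ⟨σ, hσ⟩ := Set.mem_iUnion.1 h
      exact hσ.1
  have hdisj : Pairwise fun σ τ => Disjoint (C σ) (C τ) := by
    intro σ τ hne
    refine Set.disjoint_left.2 fun u hu hu' => hne ?_
    have h := Tuple.unique_monotone hu.2.monotone hu'.2.monotone
    have hu_inj : Function.Injective u := fun i j hij => by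
      have := hu.2.injective (a₁ := σ.symm i) (a₂ := σ.symm j) (by simpa using hij)
      exact σ.symm.injective this
    exact Equiv.ext fun i => hu_inj (congrFun h i)
  have hvol (σ) : volume (C σ) = volume (A ∩ {u | StrictMono u}) := by
    have hmp := volume_measurePreserving_piCongrLeft (fun _ : Fin n => ℝ) σ.symm
    have hpre : C σ = (MeasurableEquiv.piCongrLeft (fun _ : Fin n => ℝ) σ.symm) ⁻¹'
        (A ∩ {u | StrictMono u}) := by
      ext u
      have : (MeasurableEquiv.piCongrLeft (fun _ : Fin n => ℝ) σ.symm) u = u ∘ σ := by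
        ext i
        have := MeasurableEquiv.piCongrLeft_apply_apply σ.symm (β := fun _ : Fin n => ℝ) u (σ i)
        simpa using this
      simp only [C, Set.mem_inter_iff, Set.mem_preimage, this, hsymm, Set.mem_ofPred_eq]
    rw [hpre]
    exact hmp.measure_preimage_equiv _
  rw [measure_congr hae, measure_iUnion hdisj hCm, tsum_fintype]
  simp [hvol, Fintype.card_perm]

end Sorting

theorem measurableSet_arrivalCone (n : ℕ) : MeasurableSet (arrivalCone n) := by
  have h : arrivalCone n = (⋂ i, {p : (Fin n → ℝ) × ℝ | 0 < p.1 i}) ∩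
      ((Prod.fst ⁻¹' {u : Fin n → ℝ | StrictMono (u ∘ (1 : Equiv.Perm (Fin n)))}) ∩
        ((⋂ i, {p : (Fin n → ℝ) × ℝ | p.1 i < p.2}) ∩ {p | 0 < p.2})) := by
    ext p
    simp [arrivalCone]
  rw [h]
  refine (MeasurableSet.iInter fun i => measurableSet_lt measurable_const (by fun_prop)).inter
    ((measurable_fst (measurableSet_strictMono_comp 1)).inter
      ((MeasurableSet.iInter fun i => measurableSet_lt (by fun_prop) (by fun_prop)).inter
        (measurableSet_lt measurable_const (by fun_prop))))

/-- The mass that the arrival measure gives to a symmetric event about the first `n` points. -/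
theorem arrivalMeasure_cone {n : ℕ} {A : Set (Fin n → ℝ)} (hA : MeasurableSet A)
    (hsymm : ∀ (σ : Equiv.Perm (Fin n)) (u : Fin n → ℝ), u ∘ σ ∈ A ↔ u ∈ A) :
    arrivalMeasure n (arrivalCone n ∩ Prod.fst ⁻¹' A) = ∫⁻ t in Set.Ioi 0,
      ENNReal.ofReal (Real.exp (-t) / n !) * volume ({u | ∀ i, u i ∈ Set.Ioo 0 t} ∩ A) := by
  have hm : MeasurableSet (arrivalCone n ∩ Prod.fst ⁻¹' A) :=
    (measurableSet_arrivalCone n).inter (measurable_fst hA)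
  rw [arrivalMeasure, Measure.prod_apply_symm hm, expWeight,
    lintegral_withDensity_eq_lintegral_mul _ (by fun_prop) (measurable_measure_prodMk_right hm),
    ← lintegral_indicator measurableSet_Ioi]
  refine lintegral_congr fun t => ?_
  simp only [Pi.mul_apply]
  by_cases ht : 0 < t
  · rw [Set.indicator_of_mem (by exact ht)]
    have hcube : MeasurableSet {u : Fin n → ℝ | ∀ i, u i ∈ Set.Ioo 0 t} := by
      have : {u : Fin n → ℝ | ∀ i, u i ∈ Set.Ioo 0 t} = Set.univ.pi fun _ => Set.Ioo 0 t := by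
        ext; simp
      rw [this]
      exact .univ_pi fun _ => measurableSet_Ioo
    have h1 : (fun u => (u, t)) ⁻¹' (arrivalCone n ∩ Prod.fst ⁻¹' A) =
        ({u | ∀ i, u i ∈ Set.Ioo 0 t} ∩ A) ∩ {u | StrictMono u} := by
      ext u
      simp only [arrivalCone, Set.mem_preimage, Set.mem_inter_iff, Set.mem_ofPred_eq, Set.mem_Ioo]
      constructor
      · rintro ⟨⟨h1, h2, h3, -⟩, h4⟩
        exact ⟨⟨fun i => ⟨h1 i, h3 i⟩, h4⟩, h2⟩
      · rintro ⟨⟨h1, h4⟩, h2⟩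
        exact ⟨⟨fun i => (h1 i).1, h2, fun i => (h1 i).2, ht⟩, h4⟩
    have h2 := volume_eq_factorial_mul (hcube.inter hA) (fun σ u => by
      rw [Set.mem_inter_iff, Set.mem_inter_iff, hsymm]
      refine and_congr_left fun _ => ?_
      simp only [Set.mem_ofPred_eq, Function.comp_apply]
      exact ⟨fun h i => by simpa using h (σ.symm i), fun h i => h (σ i)⟩)
    rw [h1, h2, ← mul_assoc, ENNReal.ofReal_div_of_pos (by positivity), ENNReal.ofReal_natCast,
      ENNReal.div_mul_cancel (by exact_mod_cast Nat.factorial_ne_zero n) (by simp)]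
  · rw [Set.indicator_of_notMem (by exact ht)]
    have h1 : (fun u => (u, t)) ⁻¹' (arrivalCone n ∩ Prod.fst ⁻¹' A) = ∅ := by
      ext u
      simp [arrivalCone, ht]
    rw [h1]
    simp

/-- The integral is `Γ(n + 1) / n! = 1`. This total mass forces the law of the arrivals onto the
cone, so that distinct distances and the existence of enough points need no separate proof. -/
theorem arrivalMeasure_cone_univ (n : ℕ) : arrivalMeasure n (arrivalCone n) = 1 := by
  have h := arrivalMeasure_cone (n := n) MeasurableSet.univ fun σ u => Iff.rfl
  rw [Set.preimage_univ, Set.inter_univ] at h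
  have h2 : ∀ t ∈ Set.Ioi (0 : ℝ), ENNReal.ofReal (Real.exp (-t) / n !) *
      volume ({u : Fin n → ℝ | ∀ i, u i ∈ Set.Ioo 0 t} ∩ Set.univ) =
      ENNReal.ofReal (1 / n ! * (Real.exp (-t) * t ^ (((n : ℝ) + 1) - 1))) := by
    intro t ht
    have ht' : (0 : ℝ) < t := ht
    have : {u : Fin n → ℝ | ∀ i, u i ∈ Set.Ioo 0 t} = Set.univ.pi fun _ => Set.Ioo 0 t := by
      ext; simp
    rw [Set.inter_univ, this, Real.volume_pi_Ioo, ← ENNReal.ofReal_prod_of_nonneg (by simp [ht'.le]),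
      ← ENNReal.ofReal_mul (by positivity), add_sub_cancel_right, Real.rpow_natCast]
    congr 1
    simp
    ring
  rw [h, setLIntegral_congr_fun measurableSet_Ioi h2, ← ofReal_integral_eq_lintegral_ofReal,
    integral_const_mul, ← Real.Gamma_eq_integral (by positivity), Real.Gamma_nat_eq_factorial]
  · have : (n ! : ℝ) ≠ 0 := by positivity
    field_simp
    simp
  · exact (Real.GammaIntegral_convergent (by positivity)).const_mul _
  · filter_upwards [ae_restrict_mem measurableSet_Ioi] with t ht
    have ht' : (0 : ℝ) < t := ht
    positivity

section Law

variable {Ω : Type*} [MeasurableSpace Ω] {P : Measure Ω} [IsProbabilityMeasure P] {lam : ℝ}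
  {Φ : Ω → Set Plane}

/-- The joint law of the first `n + 1` scaled distances. -/
theorem map_arrivals (hΦ : IsHPPP P lam Φ) (hlam : 0 < lam) (n : ℕ) :
    P.map (fun ω => arrivals lam n (Φ ω)) = (arrivalMeasure n).restrict (arrivalCone n) := by
  have := Measure.isProbabilityMeasure_map (μ := P) (measurable_arrivals hΦ n).aemeasurable
  have h := restrict_map_arrivals hΦ hlam n
  rw [← h, Measure.restrict_eq_self_of_ae_mem]
  refine (mem_ae_iff_prob_eq_one (measurableSet_arrivalCone n)).2 ?_
  rw [← Measure.restrict_apply_self, h, Measure.restrict_apply_self, arrivalMeasure_cone_univ]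

theorem pathLossSum_eq {lam α : ℝ} (hlam : 0 < lam) (K : ℕ) (S : Set Plane) :
    pathLossSum α K S = (lam * Real.pi) ^ (α / 2) *
      ∑ i, (arrivals lam K S).1 i ^ (-(α / 2)) := by
  have hc : 0 < lam * Real.pi := mul_pos hlam Real.pi_pos
  rw [pathLossSum, ← Finset.Ico_add_one_right_eq_Icc, Finset.sum_Ico_eq_sum_range,
    Nat.add_sub_cancel, ← Fin.sum_univ_eq_sum_range (fun i => nearestDist S (1 + i) ^ (-α)),
    Finset.mul_sum]
  refine Finset.sum_congr rfl fun i _ => ?_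
  have hr := nearestDist_nonneg S (i + 1)
  have e : (arrivals lam K S).1 i = lam * Real.pi * nearestDist S (i + 1) ^ 2 := rfl
  rw [e, Real.mul_rpow hc.le (by positivity), ← mul_assoc, ← Real.rpow_add hc,
    add_neg_cancel, Real.rpow_zero, one_mul, ← Real.rpow_natCast, ← Real.rpow_mul hr, add_comm]
  congr 1
  push_cast
  ring

/-- Condition on the `(K + 1)`-st arrival `t`. By symmetry the ordered event has `1 / K!` of the
volume in the cube of side `t`, and that volume is `t ^ K` times a Pareto probability by scaling. -/
theorem measure_pathLossSum_le (hΦ : IsHPPP P lam Φ) (hlam : 0 < lam) {α : ℝ} (hα : 0 < α)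
    (K : ℕ) (x : ℝ) : P {ω | pathLossSum α K (Φ ω) ≤ x} = ∫⁻ t in Set.Ioi 0,
      ENNReal.ofReal (Real.exp (-t) * t ^ K / K ! *
        paretoCDF α K (x / (lam * Real.pi) ^ (α / 2) * t ^ (α / 2))) := by
  have hc : 0 < (lam * Real.pi) ^ (α / 2) := Real.rpow_pos_of_pos (mul_pos hlam Real.pi_pos) _
  let A : Set (Fin K → ℝ) := {u | ∑ i, u i ^ (-(α / 2)) ≤ x / (lam * Real.pi) ^ (α / 2)}
  have hA : MeasurableSet A := measurableSet_le (by fun_prop) measurable_const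
  have hsymm (σ : Equiv.Perm (Fin K)) (u : Fin K → ℝ) : u ∘ σ ∈ A ↔ u ∈ A := by
    simp only [A, Set.mem_ofPred_eq, Function.comp_apply]
    rw [Equiv.sum_comp σ fun i => u i ^ (-(α / 2))]
  have h1 : {ω | pathLossSum α K (Φ ω) ≤ x} =
      (fun ω => arrivals lam K (Φ ω)) ⁻¹' (Prod.fst ⁻¹' A) := by
    ext ω
    simp only [Set.mem_ofPred_eq, Set.mem_preimage, A]
    rw [pathLossSum_eq hlam, le_div_iff₀' hc]
  rw [h1, ← Measure.map_apply (measurable_arrivals hΦ K) (measurable_fst hA), map_arrivals hΦ hlam,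
    Measure.restrict_apply (measurable_fst hA), Set.inter_comm, arrivalMeasure_cone hA hsymm]
  refine setLIntegral_congr_fun measurableSet_Ioi fun t ht => ?_
  have ht' : (0 : ℝ) < t := ht
  have h2 := volume_cube_sum_rpow_le hα ht' K (x / (lam * Real.pi) ^ (α / 2))
  have h3 : {u : Fin K → ℝ | ∀ i, u i ∈ Set.Ioo 0 t} ∩ A = {u | (∀ i, u i ∈ Set.Ioo 0 t) ∧
      ∑ i, u i ^ (-(α / 2)) ≤ x / (lam * Real.pi) ^ (α / 2)} := rfl
  rw [h3, h2, ← ENNReal.ofReal_mul (by positivity)]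
  congr 1
  ring

end Law

/-! ### Integration against the Erlang density -/

/-- The density of the `(K + 1)`-st point of a Poisson process of unit density. -/
def erlangDensity (K : ℕ) (t : ℝ) : ℝ := Real.exp (-t) * t ^ K / K !

theorem continuous_erlangDensity (K : ℕ) : Continuous (erlangDensity K) := by
  unfold erlangDensity; fun_prop

theorem erlangDensity_nonneg (K : ℕ) {t : ℝ} (ht : 0 ≤ t) : 0 ≤ erlangDensity K t := by
  unfold erlangDensity; positivity

theorem integrableOn_erlangDensity (K : ℕ) : IntegrableOn (erlangDensity K) (Set.Ioi 0) := by
  have h := (Real.GammaIntegral_convergent (s := (K : ℝ) + 1) (by positivity)).div_const (K ! : ℝ)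
  refine h.congr (Filter.Eventually.of_forall fun t => ?_)
  simp only [erlangDensity, add_sub_cancel_right, Real.rpow_natCast]

/-- The derivative telescopes and only the top term survives. -/
theorem hasDerivAt_erlang_tail (K : ℕ) (t : ℝ) :
    HasDerivAt (fun t => -(Real.exp (-t) * ∑ l ∈ Finset.range (K + 1), t ^ l / l !))
      (erlangDensity K t) t := by
  have hexp : HasDerivAt (fun t : ℝ => Real.exp (-t)) (-Real.exp (-t)) t := by
    simpa using (hasDerivAt_neg t).exp
  induction K with
  | zero => simpa [erlangDensity] using hexp.fun_neg
  | succ K ih =>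
    have h1 : HasDerivAt (fun t : ℝ => t ^ (K + 1) / (K + 1)!) (t ^ K / K !) t := by
      refine ((hasDerivAt_pow (K + 1) t).div_const ((K + 1)! : ℝ)).congr_deriv ?_
      rw [Nat.factorial_succ]
      have : (K ! : ℝ) ≠ 0 := by positivity
      push_cast
      field_simp
    have h2 := ih.sub (hexp.mul h1)
    refine (h2.congr_deriv ?_).congr_of_eventuallyEq (Filter.Eventually.of_forall fun s => ?_)
    · simp only [erlangDensity]
      ring
    · simp only [Finset.sum_range_succ _ (K + 1), Pi.sub_apply, Pi.mul_apply]
      ring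

theorem integral_erlangDensity (K : ℕ) {q : ℝ} (hq : 0 ≤ q) :
    ∫ t in Set.Ioi q, erlangDensity K t =
      Real.exp (-q) * ∑ l ∈ Finset.range (K + 1), q ^ l / l ! := by
  have hlim : Filter.Tendsto
      (fun t : ℝ => -(Real.exp (-t) * ∑ l ∈ Finset.range (K + 1), t ^ l / l !))
      Filter.atTop (nhds 0) := by
    simp_rw [Finset.mul_sum]
    rw [← neg_zero, ← Finset.sum_const_zero (s := Finset.range (K + 1))]
    refine (tendsto_finsetSum _ fun l _ => ?_).neg
    have := (Real.tendsto_pow_mul_exp_neg_atTop_nhds_zero l).div_const (l ! : ℝ)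
    rw [zero_div] at this
    refine this.congr fun t => by ring
  rw [integral_Ioi_of_hasDerivAt_of_tendsto' (fun t _ => hasDerivAt_erlang_tail K t)
    ((integrableOn_erlangDensity K).mono_set (Set.Ioi_subset_Ioi hq)) hlim]
  ring

theorem monotone_paretoCDF {α : ℝ} (hα : 0 < α) (K : ℕ) : Monotone (paretoCDF α K) := by
  intro y z hyz
  refine mul_le_mul_of_nonneg_left ?_ (by positivity)
  exact measureReal_mono (Set.Iic_subset_Iic.2 hyz)
    (((isLocFiniteNonneg_powMeasure_Ici _).convPow K).Iic_lt_top z).ne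

theorem paretoCDF_nonneg {α : ℝ} (hα : 0 < α) (K : ℕ) (y : ℝ) : 0 ≤ paretoCDF α K y :=
  mul_nonneg (by positivity) measureReal_nonneg

section Terms

variable {α c x : ℝ} {K l : ℕ}

/-- `(K / x) ^ (2 / α) * c` is the time at which the argument of `paretoCDF` crosses `K`, the least
value of a sum of `K` Pareto variables. -/
theorem threshold_iff (hα : 0 < α) (hc : 0 < c) (hx : 0 < x) {t : ℝ} (ht : 0 < t) :
    ((K : ℝ) < x / c ^ (α / 2) * t ^ (α / 2) ↔ ((K : ℝ) / x) ^ (2 / α) * c < t) ∧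
      (x / c ^ (α / 2) * t ^ (α / 2) < K ↔ t < ((K : ℝ) / x) ^ (2 / α) * c) := by
  have e : x / c ^ (α / 2) * t ^ (α / 2) = x * (t / c) ^ (α / 2) := by
    rw [Real.div_rpow ht.le hc.le]; ring
  have h2 : 0 < 2 / α := by positivity
  have e2 : ((t / c) ^ (α / 2)) ^ (2 / α) = t / c := by
    rw [← Real.rpow_mul (by positivity)]
    have : α / 2 * (2 / α) = 1 := by field_simp
    rw [this, Real.rpow_one]
  constructor
  · rw [e, ← div_lt_iff₀' hx, ← Real.rpow_lt_rpow_iff (by positivity) (by positivity) h2, e2,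
      lt_div_iff₀ hc]
  · rw [e, ← lt_div_iff₀' hx, ← Real.rpow_lt_rpow_iff (by positivity) (by positivity) h2, e2,
      div_lt_iff₀ hc]

theorem erlangDensity_mul_paretoTerm {lam : ℝ} (hα : 0 < α) (hlam : 0 < lam) (hx : 0 < x) (m : ℕ)
    {t : ℝ} (ht : 0 < t) :
    erlangDensity K t *
        paretoTerm α K l (x / (lam * Real.pi) ^ (α / 2) * t ^ (α / 2)) m =
      coeffA α (K - l) m * Real.Gamma ((m : ℝ) + 2 / α * (l : ℝ)) *
        x ^ (-(m : ℝ) - 2 / α * (l : ℝ)) * (1 / (K ! : ℝ)) *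
        (lam * Real.pi) ^ (1 / 2 * (m : ℝ) * α + (l : ℝ)) *
        (t ^ ((K : ℝ) - (m : ℝ) * α / 2 - (l : ℝ) + 1 - 1) * Real.exp (-t)) := by
  have hc : 0 < lam * Real.pi := mul_pos hlam Real.pi_pos
  have hcα : 0 < (lam * Real.pi) ^ (α / 2) := Real.rpow_pos_of_pos hc _
  have htα : 0 < t ^ (α / 2) := Real.rpow_pos_of_pos ht _
  rw [erlangDensity, paretoTerm, Real.mul_rpow (by positivity) htα.le,
    Real.div_rpow hx.le hcα.le, ← Real.rpow_mul hc.le, ← Real.rpow_mul ht.le]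
  have e1 : α / 2 * (-(m : ℝ) - 2 / α * (l : ℝ)) = -(1 / 2 * (m : ℝ) * α + l) := by
    field_simp
    ring
  have e2 : (K : ℝ) - (m : ℝ) * α / 2 - (l : ℝ) + 1 - 1 = K + -(1 / 2 * (m : ℝ) * α + l) := by ring
  rw [e1, e2, Real.rpow_add ht, Real.rpow_natCast, Real.rpow_neg hc.le]
  field_simp

theorem integral_erlangDensity_mul_paretoTerm {lam : ℝ} (hα : 0 < α) (hlam : 0 < lam) (hx : 0 < x)
    (m : ℕ) :
    ∫ t in Set.Ioi (((K : ℝ) / x) ^ (2 / α) * lam * Real.pi), erlangDensity K t *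
        paretoTerm α K l (x / (lam * Real.pi) ^ (α / 2) * t ^ (α / 2)) m =
      cdfTerm α lam K x l m := by
  rw [cdfTerm, upperGamma, ← integral_const_mul]
  refine setIntegral_congr_fun measurableSet_Ioi fun t ht => ?_
  have hq : 0 ≤ ((K : ℝ) / x) ^ (2 / α) * lam * Real.pi := by positivity
  exact erlangDensity_mul_paretoTerm hα hlam hx m (hq.trans_lt ht)

/-- The exponent of `y` is nonpositive, so the value at `K` dominates uniformly in `t` beyond the
threshold. -/
theorem norm_paretoTerm_le (hα : 0 < α) (hK : 1 ≤ K) {y : ℝ} (hy : (K : ℝ) ≤ y) (m : ℕ) :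
    ‖paretoTerm α K l y m‖ ≤ ‖paretoTerm α K l K m‖ := by
  have hK0 : (0 : ℝ) < K := by exact_mod_cast hK
  have hy0 : 0 < y := hK0.trans_le hy
  rw [paretoTerm, paretoTerm, norm_mul, norm_mul (_ * _) ((K : ℝ) ^ _),
    Real.norm_of_nonneg (Real.rpow_nonneg hy0.le _), Real.norm_of_nonneg (Real.rpow_nonneg hK0.le _)]
  refine mul_le_mul_of_nonneg_left ?_ (norm_nonneg _)
  refine Real.rpow_le_rpow_of_nonpos hK0 hy ?_
  have : 0 ≤ 2 / α * (l : ℝ) := by positivity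
  linarith [(Nat.cast_nonneg m : (0 : ℝ) ≤ m)]

theorem norm_erlangDensity_mul_paretoTerm_le (hα : 0 < α) (hc : 0 < c) (hx : 0 < x) (hK : 1 ≤ K)
    (m : ℕ) {t : ℝ} (ht : ((K : ℝ) / x) ^ (2 / α) * c < t) :
    ‖erlangDensity K t * paretoTerm α K l (x / c ^ (α / 2) * t ^ (α / 2)) m‖ ≤
      erlangDensity K t * ‖paretoTerm α K l K m‖ := by
  have ht0 : 0 < t := lt_of_le_of_lt (by positivity) ht
  rw [norm_mul, Real.norm_of_nonneg (erlangDensity_nonneg K ht0.le)]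
  exact mul_le_mul_of_nonneg_left
    (norm_paretoTerm_le hα hK ((threshold_iff hα hc hx ht0).1.2 ht).le m)
    (erlangDensity_nonneg K ht0.le)

theorem integrableOn_erlangDensity_mul_paretoTerm (hα : 0 < α) (hc : 0 < c) (hx : 0 < x)
    (hK : 1 ≤ K) (m : ℕ) : IntegrableOn
      (fun t => erlangDensity K t * paretoTerm α K l (x / c ^ (α / 2) * t ^ (α / 2)) m)
      (Set.Ioi (((K : ℝ) / x) ^ (2 / α) * c)) := by
  have hq : 0 ≤ ((K : ℝ) / x) ^ (2 / α) * c := by positivity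
  have hint := (((integrableOn_erlangDensity K).mono_set (Set.Ioi_subset_Ioi hq)).mul_const
    ‖paretoTerm α K l K m‖)
  refine Integrable.mono' hint ?_ ?_
  · have h := (continuous_erlangDensity K).measurable
    have : Measurable fun t =>
        erlangDensity K t * paretoTerm α K l (x / c ^ (α / 2) * t ^ (α / 2)) m := by
      unfold paretoTerm
      fun_prop
    exact this.aestronglyMeasurable
  · filter_upwards [ae_restrict_mem measurableSet_Ioi] with t ht
    exact norm_erlangDensity_mul_paretoTerm_le hα hc hx hK m ht

theorem summable_integral_norm_paretoTerm (hα : 2 < α) (hc : 0 < c) (hx : 0 < x)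
    (hl : 1 ≤ l) (hlK : l ≤ K) :
    Summable fun m : ℕ => ∫ t in Set.Ioi (((K : ℝ) / x) ^ (2 / α) * c),
      ‖erlangDensity K t * paretoTerm α K l (x / c ^ (α / 2) * t ^ (α / 2)) m‖ := by
  have hα0 : 0 < α := by linarith
  have hK := hl.trans hlK
  have hq : 0 ≤ ((K : ℝ) / x) ^ (2 / α) * c := by positivity
  have hint := (integrableOn_erlangDensity K).mono_set (Set.Ioi_subset_Ioi hq)
  refine Summable.of_nonneg_of_le (fun m => integral_nonneg fun _ => norm_nonneg _) (fun m => ?_)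
    ((summable_norm_paretoTerm hα hl hlK le_rfl).mul_left
      (∫ t in Set.Ioi (((K : ℝ) / x) ^ (2 / α) * c), erlangDensity K t))
  rw [← integral_mul_const]
  refine integral_mono_ae (integrableOn_erlangDensity_mul_paretoTerm hα0 hc hx hK m).norm
    (hint.mul_const _) ?_
  filter_upwards [ae_restrict_mem measurableSet_Ioi] with t ht
  exact norm_erlangDensity_mul_paretoTerm_le hα0 hc hx hK m ht

theorem summable_cdfTerm {lam : ℝ} (hα : 2 < α) (hlam : 0 < lam) (hx : 0 < x)
    (hl : 1 ≤ l) (hlK : l ≤ K) : Summable fun m : ℕ => cdfTerm α lam K x l m := by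
  have hc : 0 < lam * Real.pi := mul_pos hlam Real.pi_pos
  refine Summable.of_norm_bounded (summable_integral_norm_paretoTerm hα hc hx hl hlK) fun m => ?_
  rw [← integral_erlangDensity_mul_paretoTerm (by linarith) hlam hx, mul_assoc]
  exact norm_integral_le_integral_norm _

end Terms

section Law

variable {Ω : Type*} [MeasurableSpace Ω] {P : Measure Ω} [IsProbabilityMeasure P] {lam : ℝ}
  {Φ : Ω → Set Plane}

theorem measureReal_pathLossSum_le (hΦ : IsHPPP P lam Φ) (hlam : 0 < lam) {α : ℝ} (hα : 0 < α)
    (K : ℕ) (x : ℝ) :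
    IntegrableOn (fun t => erlangDensity K t *
      paretoCDF α K (x / (lam * Real.pi) ^ (α / 2) * t ^ (α / 2))) (Set.Ioi 0) ∧
    P.real {ω | pathLossSum α K (Φ ω) ≤ x} = ∫ t in Set.Ioi 0, erlangDensity K t *
      paretoCDF α K (x / (lam * Real.pi) ^ (α / 2) * t ^ (α / 2)) := by
  have h := measure_pathLossSum_le hΦ hlam hα K x
  have hm : Measurable fun t => erlangDensity K t *
      paretoCDF α K (x / (lam * Real.pi) ^ (α / 2) * t ^ (α / 2)) :=
    (continuous_erlangDensity K).measurable.mul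
      ((monotone_paretoCDF hα K).measurable.comp (by fun_prop))
  have hnn : ∀ᵐ t ∂(volume.restrict (Set.Ioi (0 : ℝ))), 0 ≤ erlangDensity K t *
      paretoCDF α K (x / (lam * Real.pi) ^ (α / 2) * t ^ (α / 2)) := by
    filter_upwards [ae_restrict_mem measurableSet_Ioi] with t ht
    exact mul_nonneg (erlangDensity_nonneg K (le_of_lt ht)) (paretoCDF_nonneg hα K _)
  refine ⟨⟨hm.aestronglyMeasurable, ?_⟩, ?_⟩
  · rw [hasFiniteIntegral_iff_ofReal hnn]
    exact h ▸ measure_lt_top P _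
  · rw [integral_eq_lintegral_of_nonneg_ae hnn hm.aestronglyMeasurable, measureReal_def, h]
    rfl

theorem measureReal_pathLossSum_le_eq_cdfFormula (hΦ : IsHPPP P lam Φ) (hlam : 0 < lam) {α : ℝ}
    (hα : 2 < α) {K : ℕ} (hK : 1 ≤ K) {x : ℝ} (hx : 0 < x) :
    P.real {ω | pathLossSum α K (Φ ω) ≤ x} = cdfFormula α lam K x := by
  have hα0 : 0 < α := by linarith
  have hc : 0 < lam * Real.pi := mul_pos hlam Real.pi_pos
  obtain ⟨hint, hP⟩ := measureReal_pathLossSum_le hΦ hlam hα0 K x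
  set q : ℝ := ((K : ℝ) / x) ^ (2 / α) * (lam * Real.pi) with hqdef
  have hq : 0 ≤ q := by positivity
  let y : ℝ → ℝ := fun t => x / (lam * Real.pi) ^ (α / 2) * t ^ (α / 2)
  let w : ℕ → ℝ := fun l =>
    (K.choose l : ℝ) * (-Real.Gamma (1 - 2 / α)) ^ l * Real.sin (2 * Real.pi * (l : ℝ) / α)
  -- The finite sum over `l` is kept inside, so that a single interchange of integral and series, in
  -- `m`, is needed.
  let H : ℕ → ℝ → ℝ := fun m t =>
    1 / Real.pi * ∑ l ∈ Finset.Icc 1 K, w l * (erlangDensity K t * paretoTerm α K l (y t) m)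
  have hterm {l : ℕ} (m : ℕ) : IntegrableOn
      (fun t => erlangDensity K t * paretoTerm α K l (y t) m) (Set.Ioi q) :=
    integrableOn_erlangDensity_mul_paretoTerm hα0 hc hx hK m
  have hval {l : ℕ} (m : ℕ) : ∫ t in Set.Ioi q, erlangDensity K t * paretoTerm α K l (y t) m =
      cdfTerm α lam K x l m := by
    rw [hqdef, ← mul_assoc]
    exact integral_erlangDensity_mul_paretoTerm hα0 hlam hx m
  have hHint (m : ℕ) : IntegrableOn (H m) (Set.Ioi q) :=
    (integrable_finsetSum _ fun l _ => (hterm m).const_mul _).const_mul _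
  have hHval (m : ℕ) : ∫ t in Set.Ioi q, H m t =
      1 / Real.pi * ∑ l ∈ Finset.Icc 1 K, w l * cdfTerm α lam K x l m := by
    simp only [H]
    rw [integral_const_mul, integral_finsetSum _ fun l _ => (hterm m).const_mul _]
    simp_rw [integral_const_mul, hval]
  have hHsum : Summable fun m => ∫ t in Set.Ioi q, ‖H m t‖ := by
    refine Summable.of_nonneg_of_le (fun m => integral_nonneg fun _ => norm_nonneg _) (fun m => ?_)
      (((summable_sum (s := Finset.Icc 1 K) fun l hl =>
        (summable_integral_norm_paretoTerm hα hc hx (Finset.mem_Icc.1 hl).1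
          (Finset.mem_Icc.1 hl).2).mul_left |w l|)).mul_left (1 / Real.pi))
    have hi : ∀ l ∈ Finset.Icc 1 K, Integrable
        (fun t => |w l| * ‖erlangDensity K t * paretoTerm α K l (y t) m‖)
          (volume.restrict (Set.Ioi q)) := fun l _ => (hterm m).norm.const_mul _
    calc ∫ t in Set.Ioi q, ‖H m t‖
        ≤ ∫ t in Set.Ioi q, 1 / Real.pi * ∑ l ∈ Finset.Icc 1 K,
            |w l| * ‖erlangDensity K t * paretoTerm α K l (y t) m‖ := by
          refine integral_mono (hHint m).norm ((integrable_finsetSum _ hi).const_mul _) fun t => ?_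
          simp only [H]
          rw [norm_mul, Real.norm_of_nonneg (by positivity)]
          refine mul_le_mul_of_nonneg_left ((norm_sum_le _ _).trans (le_of_eq ?_)) (by positivity)
          exact Finset.sum_congr rfl fun l _ => by rw [norm_mul, Real.norm_eq_abs (w l)]
      _ = _ := by
          rw [integral_const_mul, integral_finsetSum _ hi]
          simp_rw [integral_const_mul]
          rfl
  have hcdf : ∀ t ∈ Set.Ioi q, erlangDensity K t * paretoCDF α K (y t) =
      erlangDensity K t + ∑' m, H m t := by
    intro t ht
    have ht0 : 0 < t := hq.trans_lt ht
    have hKy : (K : ℝ) < y t := (threshold_iff hα0 hc hx ht0).1.2 ht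
    have hs : ∀ l ∈ Finset.Icc 1 K, Summable fun m =>
        w l * (erlangDensity K t * paretoTerm α K l (y t) m) := fun l hl =>
      (((summable_norm_paretoTerm hα (Finset.mem_Icc.1 hl).1 (Finset.mem_Icc.1 hl).2
        hKy.le).of_norm).mul_left _).mul_left _
    rw [paretoCDF_eq hα hKy]
    simp only [H]
    rw [tsum_mul_left, Summable.tsum_finsetSum hs]
    simp_rw [tsum_mul_left]
    rw [mul_add, mul_one, mul_left_comm, Finset.mul_sum]
    congr 2
    exact Finset.sum_congr rfl fun l _ => by ring
  have hsub : ∫ t in Set.Ioi 0, erlangDensity K t * paretoCDF α K (y t) =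
      ∫ t in Set.Ioi q, erlangDensity K t * paretoCDF α K (y t) := by
    refine setIntegral_eq_of_subset_of_ae_sdiff_eq_zero measurableSet_Ioi.nullMeasurableSet
      (Set.Ioi_subset_Ioi hq) ?_
    -- At `t = q` the argument equals `K`, where `paretoCDF_of_lt` does not apply; that point is
    -- null.
    have hne : ∀ᵐ t : ℝ, t ≠ q := by simp [ae_iff]
    filter_upwards [hne] with t ht hmem
    have ht0 : (0 : ℝ) < t := hmem.1
    have htq : t ≤ q := not_lt.1 hmem.2
    rw [paretoCDF_of_lt α ((threshold_iff hα0 hc hx ht0).2.2 (lt_of_le_of_ne htq ht)), mul_zero]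
  have hErl := (integrableOn_erlangDensity K).mono_set (Set.Ioi_subset_Ioi hq)
  -- The sum of the series is a difference of two functions already known to be integrable.
  have hdiff : IntegrableOn (fun t => ∑' m, H m t) (Set.Ioi q) := by
    refine ((hint.mono_set (Set.Ioi_subset_Ioi hq)).sub hErl).congr ?_
    filter_upwards [ae_restrict_mem measurableSet_Ioi] with t ht
    have := hcdf t ht
    simp only [Pi.sub_apply]
    linarith
  rw [hP, hsub, setIntegral_congr_fun measurableSet_Ioi hcdf, integral_add hErl hdiff,
    integral_erlangDensity K hq, ← integral_tsum_of_summable_integral_norm hHint hHsum]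
  simp_rw [hHval]
  rw [tsum_mul_left, Summable.tsum_finsetSum fun l hl =>
    (summable_cdfTerm hα hlam hx (Finset.mem_Icc.1 hl).1 (Finset.mem_Icc.1 hl).2).mul_left _]
  simp_rw [tsum_mul_left]
  rw [cdfFormula, show lam * Real.pi * ((K : ℝ) / x) ^ (2 / α) = q by rw [hqdef, mul_comm]]

theorem measureReal_pathLossSum_le_of_nonpos (hΦ : IsHPPP P lam Φ) (hlam : 0 < lam) {α : ℝ}
    (hα : 0 < α) {K : ℕ} (hK : 1 ≤ K) {x : ℝ} (hx : x ≤ 0) :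
    P.real {ω | pathLossSum α K (Φ ω) ≤ x} = 0 := by
  have hc : 0 < (lam * Real.pi) ^ (α / 2) := Real.rpow_pos_of_pos (mul_pos hlam Real.pi_pos) _
  rw [(measureReal_pathLossSum_le hΦ hlam hα K x).2]
  refine setIntegral_eq_zero_of_forall_eq_zero fun t ht => ?_
  have ht' : (0 : ℝ) < t := ht
  rw [paretoCDF_of_lt, mul_zero]
  have h1 : x / (lam * Real.pi) ^ (α / 2) * t ^ (α / 2) ≤ 0 :=
    mul_nonpos_of_nonpos_of_nonneg (div_nonpos_of_nonpos_of_nonneg hx hc.le) (by positivity)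
  have h2 : (1 : ℝ) ≤ K := by exact_mod_cast hK
  linarith

end Law

end CoopBS

end

/-! ### The distribution function of the received power -/

theorem mainTheorem3 {Ω : Type*} [MeasurableSpace Ω] (P : Measure Ω) [IsProbabilityMeasure P]
    (lam α : ℝ) (hlam : 0 < lam) (hα : 2 < α) (K L : ℕ) (hK : 1 ≤ K) (hL : 1 ≤ L)
    (Φ : Ω → Set CoopBS.Plane) (hΦ : CoopBS.IsHPPP P lam Φ) :
    Measurable (fun ω => CoopBS.receivedPower α L K (Φ ω)) ∧
    (∀ x : ℝ, cdf (P.map (fun ω => CoopBS.receivedPower α L K (Φ ω))) x =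
      P.real {ω | CoopBS.pathLossSum α K (Φ ω) ≤ x / (L : ℝ)}) ∧
    (∀ x : ℝ, 0 < x →
      (∀ l ∈ Finset.Icc 1 K, Summable (fun m : ℕ => CoopBS.cdfTerm α lam K x l m)) ∧
      P.real {ω | CoopBS.pathLossSum α K (Φ ω) ≤ x} = CoopBS.cdfFormula α lam K x) ∧
    (∀ x : ℝ, x ≤ 0 → P.real {ω | CoopBS.pathLossSum α K (Φ ω) ≤ x} = 0) := by
  have hmeas : Measurable fun ω => CoopBS.receivedPower α L K (Φ ω) :=
    (CoopBS.measurable_pathLossSum hΦ α K).const_mul _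
  have hL0 : (0 : ℝ) < L := by exact_mod_cast hL
  refine ⟨hmeas, fun x => ?_, fun x hx => ⟨fun l hl => ?_, ?_⟩, fun x hx => ?_⟩
  · have := Measure.isProbabilityMeasure_map (μ := P) hmeas.aemeasurable
    rw [cdf_eq_real, map_measureReal_apply hmeas measurableSet_Iic]
    congr 1
    ext ω
    simp only [Set.mem_preimage, Set.mem_Iic, Set.mem_ofPred_eq, CoopBS.receivedPower]
    rw [le_div_iff₀' hL0]
  -- For real series `Summable` is the same as absolute convergence.
  · exact CoopBS.summable_cdfTerm hα hlam hx (Finset.mem_Icc.1 hl).1 (Finset.mem_Icc.1 hl).2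
  · exact CoopBS.measureReal_pathLossSum_le_eq_cdfFormula hΦ hlam hα hK hx
  · exact CoopBS.measureReal_pathLossSum_le_of_nonpos hΦ hlam (by linarith) hK hx
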